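/- **Setting.** All Hilbert spaces are finite-dimensional and $\log=\log_2$. $\mathcal D_\le(X)$, $\mathcal D_=(X)$ are the positive semidefinite operators on $X$ with trace $\le 1$, resp. $=1$. For $\rho\in\mathcal D_\le(X)$ and $\sigma\ge 0$ put $D_{\max}(\rho\|\sigma)=\inf\{\lambda\in\mathbb R: 2^\lambda\sigma\ge\rho\}$. For $\rho^{XY}\in\mathcal D_\le(X\otimes Y)$ put $$H_{\min}(X|Y)_\rho=-\inf_{\sigma\in\mathcal D_=(Y)}D_{\max}(\rho^{XY}\|I^X\otimes\sigma^Y),\qquad I_{\max}(X;Y)_\rho=\inf_{\sigma\in\mathcal D_=(Y)}D_{\max}(\rho^{XY}\|\rho^X\otimes\sigma^Y),$$ and $H_{\max}(X|Y)_\rho=-H_{\min}(X|Z)_\rho$ for a purification $\rho^{XYZ}$ of $\rho^{XY}$ (the choice is immaterial). For $\rho,\sigma\in\mathcal D_\le(X)$ the purified distance is $P(\rho,\sigma)=\sqrt{1-\bar F(\rho,\sigma)^2}$ with $\bar F(\rho,\sigma)=\|\sqrt\rho\sqrt\sigma\|_1+\sqrt{(1-\mathrm{Tr}\rho)(1-\mathrm{Tr}\sigma)}$.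 With $\mathcal B^\epsilon(\rho)=\{\bar\rho\in\mathcal D_\le: P(\rho,\bar\rho)\le\epsilon\}$, set $H_{\min}^\epsilon(X|Y)_\rho=\sup_{\bar\rho\in\mathcal B^\epsilon(\rho^{XY})}H_{\min}(X|Y)_{\bar\rho}$, $H_{\max}^\epsilon(X|Y)_\rho=\inf_{\bar\rho\in\mathcal B^\epsilon(\rho^{XY})}H_{\max}(X|Y)_{\bar\rho}$ and $I_{\max}^\epsilon(X;Y)_\rho=\inf_{\bar\rho\in\mathcal B^\epsilon(\rho^{XY})}I_{\max}(X;Y)_{\bar\rho}$. **One-way state redistribution.** Let $\rho^{ABC}\in\mathcal D_=(A\otimes B\otimes C)$ with purification $\rho^{ABCR}$. A one-way protocol $\Pi$ consists of finite-dimensional systems $T_A^{in},T_B^{in},T_A^{out},T_B^{out},Q$, a completely positive trace preserving map $ACT_A^{in}\to AT_A^{out}Q$ applied by Alice, transmission of $Q$ to Bob, and a completely positive trace preserving map $QBT_B^{in}\to C'BT_B^{out}$ applied by Bob, where $C'\cong C$. Its quantum communication cost is $q(\Pi)=\log|Q|$. It is a quantum state redistribution of $\rho^{ABC}$ with error $\epsilon$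 if there are normalized states $\Phi_1$ on $T_A^{in}T_B^{in}$ and $\Phi_2$ on $T_A^{out}T_B^{out}$, both arbitrary (in particular, arbitrary entanglement assistance is allowed), such that $$P\big((\Pi\otimes\mathrm{id}_R)(\Phi_1\otimes\rho^{ABCR}),\ \Phi_2\otimes\rho^{ABC'R}\big)\le\epsilon .$$ **Proposition (Converse One-Shot Quantum Communication).** Let $\epsilon_1\in(0,1)$, $\epsilon_2\in(0,1-\epsilon_1)$, and let $\rho\in\mathcal D_=(A\otimes B\otimes C)$ have purification $\rho^{ABCR}$. Then for every quantum state redistribution $\Pi$ of $\rho^{ABC}$ with error $\epsilon_1$, all the quantities below are finite and $$q(\Pi)\ge\tfrac12 I_{\max}^{\epsilon_1+\epsilon_2}(R;BC)_\rho-\tfrac12 I_{\max}^{\epsilon_2}(R;B)_\rho,$$ $$q(\Pi)\ge\tfrac12 H_{\min}^{\epsilon_2}(R|B)_\rho-\tfrac12 H_{\min}^{\epsilon_1+\epsilon_2}(R|BC)_\rho,$$ $$q(\Pi)\ge\tfrac12 H_{\max}^{\epsilon_1+\epsilon_2}(R|B)_\rho-\tfrac12 H_{\max}^{\epsilon_2}(R|BC)_\rho,$$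 and the same three bounds hold with $B$ replaced by $A$ in the entropic quantities. -/

import Mathlib

/-!
Finite-dimensional quantum systems are given by finite index types `X` (the orthonormal basis of
the Hilbert space `ℂ^X`); operators on `X` are complex matrices indexed by `X`, and `X ⊗ Y` is
indexed by `X × Y`. All logarithms are to base `2`.
-/

open scoped MatrixOrder ComplexOrder

noncomputable section

namespace QSR

/-! ### States, channels -/

section States

variable {X Y Z : Type*} [Fintype X] [DecidableEq X] [Fintype Y] [DecidableEq Y]

/-- The set `D_≤(X)` of sub-normalized states. -/
def subStates (X : Type*) [Fintype X] [DecidableEq X] : Set (Matrix X X ℂ) :=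
  {ρ | ρ.PosSemidef ∧ ρ.trace.re ≤ 1}

/-- The set `D_=(X)` of normalized states. -/
def states (X : Type*) [Fintype X] [DecidableEq X] : Set (Matrix X X ℂ) :=
  {ρ | ρ.PosSemidef ∧ ρ.trace = 1}

/-- The rank-one operator `|ψ⟩⟨ψ|`. -/
def ketbra (ψ : X → ℂ) : Matrix X X ℂ := Matrix.vecMulVec ψ (star ψ)

/-- The partial trace over the second factor. -/
def traceSnd (M : Matrix (X × Y) (X × Y) ℂ) : Matrix X X ℂ :=
  Matrix.of fun x x' => ∑ y, M (x, y) (x', y)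

/-- `τ`, an operator on `X ⊗ Y`, is a purification of `ρ`, an operator on `X`. -/
def IsPurification (τ : Matrix (X × Y) (X × Y) ℂ) (ρ : Matrix X X ℂ) : Prop :=
  (∃ ψ : X × Y → ℂ, τ = ketbra ψ) ∧ traceSnd τ = ρ

/-- The map `Φ ⊗ id_Z`: `Φ` is applied to the `X`-part of an operator on `X ⊗ Z`. -/
def tensorId (Z : Type*) (Φ : Matrix X X ℂ →ₗ[ℂ] Matrix Y Y ℂ) :
    Matrix (X × Z) (X × Z) ℂ →ₗ[ℂ] Matrix (Y × Z) (Y × Z) ℂ where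
  toFun M := Matrix.of fun p p' =>
    Φ (Matrix.of fun x x' => M (x, p.2) (x', p'.2)) p.1 p'.1
  map_add' M N := by
    ext p p'
    exact congrFun (congrFun (Φ.map_add (Matrix.of fun x x' => M (x, p.2) (x', p'.2))
      (Matrix.of fun x x' => N (x, p.2) (x', p'.2))) p.1) p'.1
  map_smul' c M := by
    ext p p'
    exact congrFun (congrFun (Φ.map_smul c
      (Matrix.of fun x x' => M (x, p.2) (x', p'.2))) p.1) p'.1

/-- Quantum channels: completely positive trace preserving linear maps. -/
def IsChannel (Φ : Matrix X X ℂ →ₗ[ℂ] Matrix Y Y ℂ) : Prop :=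
  (∀ (k : ℕ) (M : Matrix (X × Fin k) (X × Fin k) ℂ),
    M.PosSemidef → (tensorId (Fin k) Φ M).PosSemidef) ∧
  ∀ M : Matrix X X ℂ, (Φ M).trace = M.trace

end States

/-! ### Entropy measures -/

section Entropies

variable {X A B : Type*} [Fintype X] [DecidableEq X]
  [Fintype A] [DecidableEq A] [Fintype B] [DecidableEq B]

/-- The max-relative entropy `inf {λ ∈ ℝ : 2^λ σ ≥ ρ}`, an extended real
(the infimum of the empty set being `+∞`). -/
def Dmax (ρ σ : Matrix X X ℂ) : EReal :=
  ⨅ (l : ℝ) (_ : ((2 : ℝ) ^ l • σ - ρ).PosSemidef), (l : EReal)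

/-- The conditional min-entropy `H_min(A|B)_ρ`. -/
def Hmin (ρ : Matrix (A × B) (A × B) ℂ) : EReal :=
  -⨅ σ ∈ states B, Dmax ρ (Matrix.kroneckerMap (· * ·) (1 : Matrix A A ℂ) σ)

/-- The state vector `∑_{x,y} (√ρ)_{x y} |x⟩|y⟩` on `X ⊗ X`, which purifies `ρ`. -/
def canonicalPurification (ρ : Matrix X X ℂ) : X × X → ℂ :=
  fun p => CFC.sqrt ρ p.1 p.2

theorem canonicalPurification_isPurification {ρ : Matrix X X ℂ} (hρ : ρ.PosSemidef) :
    IsPurification (ketbra (canonicalPurification ρ)) ρ := by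
  refine ⟨⟨_, rfl⟩, ?_⟩
  have h0 : (CFC.sqrt ρ).conjTranspose = CFC.sqrt ρ := (Matrix.nonneg_iff_posSemidef.1 (CFC.sqrt_nonneg ρ)).1
  have h1 : CFC.sqrt ρ * (CFC.sqrt ρ).conjTranspose = ρ := by
    rw [h0]
    exact CFC.sqrt_mul_sqrt_self ρ hρ.nonneg
  ext x x'
  conv_rhs => rw [← h1]
  simp [traceSnd, ketbra, canonicalPurification, Matrix.vecMulVec_apply, Matrix.mul_apply]

/-- Given an operator on `(A ⊗ B) ⊗ R`, the reduced operator on `A ⊗ R`. -/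
def dropMiddle {R : Type*} (M : Matrix ((A × B) × R) ((A × B) × R) ℂ) :
    Matrix (A × R) (A × R) ℂ :=
  Matrix.of fun p p' => ∑ b, M ((p.1, b), p.2) ((p'.1, b), p'.2)

/-- The conditional max-entropy `H_max(A|B)_ρ = -H_min(A|R)_ρ`, where `ρ^{ABR}` is the canonical
purification of `ρ^{AB}`; the value is the same for every purification. -/
def Hmax (ρ : Matrix (A × B) (A × B) ℂ) : EReal :=
  -Hmin (dropMiddle (ketbra (canonicalPurification ρ)))

/-- The max-information `I_max(A:B)_ρ` that `B` has about `A`. -/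
def Imax (ρ : Matrix (A × B) (A × B) ℂ) : EReal :=
  ⨅ σ ∈ states B, Dmax ρ (Matrix.kroneckerMap (· * ·) (traceSnd ρ) σ)

/-- The trace norm `‖M‖₁ = Tr √(M M†)`. -/
def traceNorm (M : Matrix X X ℂ) : ℝ := (CFC.sqrt (M * M.conjTranspose)).trace.re

/-- The fidelity `F(ρ, σ) = ‖√ρ √σ‖₁`. -/
def fidelity (ρ σ : Matrix X X ℂ) : ℝ := traceNorm (CFC.sqrt ρ * CFC.sqrt σ)

/-- The generalized fidelity of sub-normalized states. -/
def genFidelity (ρ σ : Matrix X X ℂ) : ℝ :=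
  fidelity ρ σ + Real.sqrt ((1 - ρ.trace.re) * (1 - σ.trace.re))

/-- The purified distance of sub-normalized states. -/
def purifiedDist (ρ σ : Matrix X X ℂ) : ℝ := Real.sqrt (1 - genFidelity ρ σ ^ 2)

/-- The `ε`-ball around `ρ` in the sub-normalized states. -/
def smoothBall (ε : ℝ) (ρ : Matrix X X ℂ) : Set (Matrix X X ℂ) :=
  {ρ' | ρ' ∈ subStates X ∧ purifiedDist ρ ρ' ≤ ε}

/-- The smooth conditional min-entropy `H_min^ε(A|B)_ρ`. -/
def smoothHmin (ε : ℝ) (ρ : Matrix (A × B) (A × B) ℂ) : EReal :=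
  ⨆ ρ' ∈ smoothBall ε ρ, Hmin ρ'

/-- The smooth conditional max-entropy `H_max^ε(A|B)_ρ`. -/
def smoothHmax (ε : ℝ) (ρ : Matrix (A × B) (A × B) ℂ) : EReal :=
  ⨅ ρ' ∈ smoothBall ε ρ, Hmax ρ'

/-- The smooth max-information `I_max^ε(A:B)_ρ`. -/
def smoothImax (ε : ℝ) (ρ : Matrix (A × B) (A × B) ℂ) : EReal :=
  ⨅ ρ' ∈ smoothBall ε ρ, Imax ρ'

end Entropies

/-! ### Reduced states of `ρ^{ABCR}` -/

section Marginals

variable {A B C R : Type*} [Fintype A] [DecidableEq A] [Fintype B] [DecidableEq B]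
  [Fintype C] [DecidableEq C]

/-- `ρ^{RB}`. -/
def redRB (τ : Matrix ((A × B × C) × R) ((A × B × C) × R) ℂ) : Matrix (R × B) (R × B) ℂ :=
  Matrix.of fun p p' => ∑ a, ∑ c, τ ((a, p.2, c), p.1) ((a, p'.2, c), p'.1)

/-- `ρ^{RA}`. -/
def redRA (τ : Matrix ((A × B × C) × R) ((A × B × C) × R) ℂ) : Matrix (R × A) (R × A) ℂ :=
  Matrix.of fun p p' => ∑ b, ∑ c, τ ((p.2, b, c), p.1) ((p'.2, b, c), p'.1)

/-- `ρ^{RBC}`. -/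
def redRBC (τ : Matrix ((A × B × C) × R) ((A × B × C) × R) ℂ) :
    Matrix (R × (B × C)) (R × (B × C)) ℂ :=
  Matrix.of fun p p' => ∑ a, τ ((a, p.2.1, p.2.2), p.1) ((a, p'.2.1, p'.2.2), p'.1)

/-- `ρ^{RAC}`. -/
def redRAC (τ : Matrix ((A × B × C) × R) ((A × B × C) × R) ℂ) :
    Matrix (R × (A × C)) (R × (A × C)) ℂ :=
  Matrix.of fun p p' => ∑ b, τ ((p.2.1, b, p.2.2), p.1) ((p'.2.1, b, p'.2.2), p'.1)

end Marginals

/-! ### One-way protocols and state redistribution -/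

/-- A one-way protocol. Alice holds `A C T_A` and Bob holds `B T_B`. Alice applies a channel
`A C T_A → A T_A' Q`, sends the system `Q` to Bob, and Bob applies a channel
`Q B T_B → C' B T_B'`, where `C'` is a copy of `C`. -/
structure OneWayProtocol (A B C TA TB TA' TB' Q : Type*)
    [Fintype A] [DecidableEq A] [Fintype B] [DecidableEq B] [Fintype C] [DecidableEq C]
    [Fintype TA] [DecidableEq TA] [Fintype TB] [DecidableEq TB]
    [Fintype TA'] [DecidableEq TA'] [Fintype TB'] [DecidableEq TB']
    [Fintype Q] [DecidableEq Q] where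
  /-- Alice's local operation -/
  enc : Matrix (A × C × TA) (A × C × TA) ℂ →ₗ[ℂ] Matrix (A × TA' × Q) (A × TA' × Q) ℂ
  /-- Bob's local operation -/
  dec : Matrix (Q × B × TB) (Q × B × TB) ℂ →ₗ[ℂ] Matrix (C × B × TB') (C × B × TB') ℂ
  enc_isChannel : IsChannel enc
  dec_isChannel : IsChannel dec

namespace OneWayProtocol

variable {A B C R TA TB TA' TB' Q : Type*}
  [Fintype A] [DecidableEq A] [Fintype B] [DecidableEq B] [Fintype C] [DecidableEq C]
  [Fintype R] [DecidableEq R]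
  [Fintype TA] [DecidableEq TA] [Fintype TB] [DecidableEq TB]
  [Fintype TA'] [DecidableEq TA'] [Fintype TB'] [DecidableEq TB']
  [Fintype Q] [DecidableEq Q]

/-- The regrouping `(A T_A' Q) ⊗ (B T_B) ≃ (Q B T_B) ⊗ (A T_A')`: the system `Q` goes from Alice
to Bob. -/
def sendEquiv (A B TA' TB Q : Type*) :
    ((A × TA' × Q) × (B × TB)) ≃ ((Q × B × TB) × (A × TA')) where
  toFun p := ((p.1.2.2, p.2.1, p.2.2), (p.1.1, p.1.2.1))
  invFun p := ((p.2.1, p.2.2, p.1.1), (p.1.2.1, p.1.2.2))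
  left_inv _ := rfl
  right_inv _ := rfl

/-- The map `A C T_A ⊗ B T_B → A T_A' ⊗ C' B T_B'` implemented by the protocol. -/
def channel (P : OneWayProtocol A B C TA TB TA' TB' Q) :
    Matrix ((A × C × TA) × (B × TB)) ((A × C × TA) × (B × TB)) ℂ →ₗ[ℂ]
      Matrix ((A × TA') × (C × B × TB')) ((A × TA') × (C × B × TB')) ℂ :=
  (Matrix.reindexLinearEquiv ℂ ℂ (Equiv.prodComm (C × B × TB') (A × TA'))
      (Equiv.prodComm (C × B × TB') (A × TA'))).toLinearMap ∘ₗ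
    tensorId (A × TA') P.dec ∘ₗ
    (Matrix.reindexLinearEquiv ℂ ℂ (sendEquiv A B TA' TB Q)
      (sendEquiv A B TA' TB Q)).toLinearMap ∘ₗ
    tensorId (B × TB) P.enc

/-- The quantum communication cost: the number `log₂ |Q|` of qubits sent. -/
def cost (_P : OneWayProtocol A B C TA TB TA' TB' Q) : ℝ := Real.logb 2 (Fintype.card Q)

/-- The operator `Φ₁^{T_A T_B} ⊗ ρ^{ABCR}`, with systems ordered as
`((A C T_A) ⊗ (B T_B)) ⊗ R`. -/
def input (Φ₁ : Matrix (TA × TB) (TA × TB) ℂ)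
    (τ : Matrix ((A × B × C) × R) ((A × B × C) × R) ℂ) :
    Matrix (((A × C × TA) × (B × TB)) × R) (((A × C × TA) × (B × TB)) × R) ℂ :=
  Matrix.of fun p p' =>
    Φ₁ (p.1.1.2.2, p.1.2.2) (p'.1.1.2.2, p'.1.2.2) *
      τ ((p.1.1.1, p.1.2.1, p.1.1.2.1), p.2) ((p'.1.1.1, p'.1.2.1, p'.1.1.2.1), p'.2)

/-- The operator `Φ₂^{T_A' T_B'} ⊗ ρ^{ABC'R}`, with systems ordered as
`((A T_A') ⊗ (C' B T_B')) ⊗ R`. -/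
def target (Φ₂ : Matrix (TA' × TB') (TA' × TB') ℂ)
    (τ : Matrix ((A × B × C) × R) ((A × B × C) × R) ℂ) :
    Matrix (((A × TA') × (C × B × TB')) × R) (((A × TA') × (C × B × TB')) × R) ℂ :=
  Matrix.of fun p p' =>
    Φ₂ (p.1.1.2, p.1.2.2.2) (p'.1.1.2, p'.1.2.2.2) *
      τ ((p.1.1.1, p.1.2.2.1, p.1.2.1), p.2) ((p'.1.1.1, p'.1.2.2.1, p'.1.2.1), p'.2)

/-- The protocol is a quantum state redistribution with error `ε` of the state purified by `τ`:
for some normalized states `Φ₁` (the entanglement assistance) and `Φ₂` (the entanglement left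
over), it maps `Φ₁ ⊗ ρ^{ABCR}` to within purified distance `ε` of `Φ₂ ⊗ ρ^{ABC'R}`. -/
def IsStateRedistribution (P : OneWayProtocol A B C TA TB TA' TB' Q)
    (τ : Matrix ((A × B × C) × R) ((A × B × C) × R) ℂ) (ε : ℝ) : Prop :=
  ∃ Φ₁ ∈ states (TA × TB), ∃ Φ₂ ∈ states (TA' × TB'),
    purifiedDist (tensorId R P.channel (input Φ₁ τ)) (target Φ₂ τ) ≤ ε

end OneWayProtocol

/-- `X` and `Y` are finite, and `q ≥ X/2 - Y/2`. -/
def GeHalfDiff (q : ℝ) (X Y : EReal) : Prop :=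
  ∃ x y : ℝ, X = x ∧ Y = y ∧ q ≥ 1 / 2 * x - 1 / 2 * y

end QSR

end

open Matrix
open scoped Kronecker

set_option linter.unusedSectionVars false

namespace QSR

/-! ### Contractions and factorization through square roots -/

section Contractions

variable {X Y Z : Type*} [Fintype X] [DecidableEq X] [Fintype Y] [DecidableEq Y]
  [Fintype Z] [DecidableEq Z]

/-! The core is a dimension bound. For `M ≥ 0` on `X ⊗ Y` one has `M ≤ |X| · 1 ⊗ M^Y`
(`le_card_smul_one_kronecker_traceFst`). Alice's operation leaves the state of `B T_B R` equal to
`ρ^{RB} ⊗ Φ₁^{T_B}`, so once Bob holds `Q`, an inequality `ρ^{RB} ≤ c N ⊗ σ` gives a bound on `Q B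
T_B R` with a factor `|Q|`. A second factor `|Q|` comes from normalizing `1_Q` to a state. Bob's
channel and a partial trace preserve the inequality, which yields `ω^{RBC} ≤ |Q|² c N ⊗ σ'`
(`reduce_le`). The exponent thus grows by at most `2 log |Q|`, both for `N = 1` (min-entropy) and
for `N` the marginal on `R` (max-information).

Smoothing: a state near `ρ^{RB}` extends to one equally near the global pure state, by Uhlmann's
theorem. The protocol is run on that extension. Monotonicity of the fidelity and the triangle
inequality through the actual output place the result within `ε₁ + ε₂` of `ρ^{RBC}`
(`IsStateRedistribution.exists_near`). This proves the bounds for `I_max` and `H_min` on Bob's side.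

For Alice's side the protocol is reversed. Stinespring dilation makes both operations isometric.
Since `ρ^{ABCR}` is pure, Uhlmann's theorem keeps the target a product with it, so the error does
not grow. The isometries have channels as left inverses; running these backwards is a redistribution
from Bob to Alice with the same `Q` and the same error (`IsStateRedistribution.exists_reverse`).

The bounds for `H_max` then follow from the duality `H_max^ε(R|B) = -H_min^ε(R|AC)`
(`smoothHmax_eq_neg_smoothHmin_flip`), which turns each of them into the `H_min` bound of the other
party.

Fidelity is handled throughout as the maximum of `Re Tr (a bᴴ)` over `a aᴴ ≤ ρ`, `b bᴴ ≤ σ`.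
Allowing inequalities, hence contractions instead of isometries, removes all constraints on the
dimension of the purifying system. -/

theorem mul_mul_conjTranspose_mono {A B : Matrix X X ℂ} (h : A ≤ B) (M : Matrix Y X ℂ) :
    M * A * Mᴴ ≤ M * B * Mᴴ := by
  rw [Matrix.le_iff] at h ⊢
  simpa [Matrix.mul_sub, Matrix.sub_mul] using h.mul_mul_conjTranspose_same M

theorem trace_re_mono {A B : Matrix X X ℂ} (h : A ≤ B) : A.trace.re ≤ B.trace.re := by
  rw [Matrix.le_iff] at h
  have := (Complex.le_def.1 h.trace_nonneg).1
  simp at this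
  linarith

theorem posSemidef_trace_eq_re {A : Matrix X X ℂ} (h : A.PosSemidef) :
    A.trace = (A.trace.re : ℂ) := by
  have := (Complex.le_def.1 h.trace_nonneg).2
  apply Complex.ext <;> simp at this ⊢
  exact this.symm

/-- If `K Kᴴ ≤ 1` then `Kᴴ K ≤ 1`. -/
theorem conjTranspose_mul_self_le_one {K : Matrix X Y ℂ} (h : K * Kᴴ ≤ 1) : Kᴴ * K ≤ 1 := by
  have h1 : Kᴴ * K * (Kᴴ * K) ≤ Kᴴ * K := by
    simpa [Matrix.mul_assoc] using mul_mul_conjTranspose_mono h Kᴴ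
  rw [Matrix.le_iff] at h1 ⊢
  have h2 : (1 - Kᴴ * K).IsHermitian := by
    simp [Matrix.IsHermitian]
  have h3 := (posSemidef_self_mul_conjTranspose (1 - Kᴴ * K)).add h1
  rw [h2.eq] at h3
  convert h3 using 1
  noncomm_ring

theorem contraction_mul {K : Matrix X Y ℂ} {L : Matrix Y Z ℂ} (hK : K * Kᴴ ≤ 1)
    (hL : L * Lᴴ ≤ 1) : (K * L) * (K * L)ᴴ ≤ 1 := by
  refine le_trans ?_ hK
  simpa [Matrix.mul_assoc] using mul_mul_conjTranspose_mono hL K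

/-- Factorization through a positive semidefinite operator: `a aᴴ ≤ p²` implies `a = p K` for a
contraction `K`. -/
theorem exists_contraction_of_le {p : Matrix X X ℂ} (hp : p.PosSemidef) {a : Matrix X Y ℂ}
    (h : a * aᴴ ≤ p * p) :
    ∃ K : Matrix X Y ℂ, K * Kᴴ ≤ 1 ∧ a = p * K ∧ (a * aᴴ = p * p → a * Kᴴ = p) := by
  have hsa : IsSelfAdjoint p := hp.1
  -- With `0⁻¹ = 0` this is the pseudo-inverse of `p`, so `p * q` is the projection onto the range
  -- of `p`, and `K = q * a` will do.
  set q : Matrix X X ℂ := cfc (fun x : ℝ => x⁻¹) p with hq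
  have hcont : ∀ f : ℝ → ℝ, ContinuousOn f (spectrum ℝ p) := fun f =>
    (Matrix.finite_real_spectrum (A := p)).continuousOn f
  have hqsa : qᴴ = q := (cfc_predicate (fun x : ℝ => x⁻¹) p : IsSelfAdjoint q)
  have hid : p = cfc (fun x : ℝ => x) p := (cfc_id' ℝ p).symm
  have hpq : p * q = cfc (fun x : ℝ => x * x⁻¹) p := by
    rw [cfc_mul _ _ p (hcont _) (hcont _), ← hid]
  have hqp : q * p = cfc (fun x : ℝ => x * x⁻¹) p := by
    rw [← cfc_congr (f := fun x : ℝ => x⁻¹ * x) (fun x _ => mul_comm _ _),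
      cfc_mul _ _ p (hcont _) (hcont _), ← hid]
  have hcomm : q * p = p * q := hqp.trans hpq.symm
  have hpqp : p * q * p = p := by
    conv_lhs => rw [hpq]
    conv_lhs => rhs; rw [hid]
    rw [← cfc_mul _ _ p (hcont _) (hcont _)]
    conv_rhs => rw [hid]
    exact cfc_congr fun x _ => by
      by_cases hx : x = 0 <;> simp [hx]
  have hpqh : (p * q)ᴴ = p * q := by
    rw [conjTranspose_mul, hqsa, hp.1.eq, hcomm]
  have hproj : p * q * (p * q) = p * q := by
    rw [← Matrix.mul_assoc, hpqp]
  have hle1 : p * q ≤ 1 := by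
    rw [Matrix.le_iff]
    have : (1 - p * q) = (1 - p * q) * (1 - p * q)ᴴ := by
      rw [conjTranspose_sub, hpqh, conjTranspose_one, Matrix.mul_sub, Matrix.sub_mul 1 _ (p * q),
        hproj]
      simp
    rw [this]
    exact posSemidef_self_mul_conjTranspose _
  -- Compressing `a aᴴ ≤ p²` to the kernel of `p` makes the right-hand side vanish.
  have hz : (1 - p * q) * a = 0 := by
    rw [← Matrix.self_mul_conjTranspose_eq_zero]
    have h1 := mul_mul_conjTranspose_mono h (1 - p * q)
    have h2 : (1 - p * q) * (p * p) * (1 - p * q)ᴴ = 0 := by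
      rw [← Matrix.mul_assoc, Matrix.sub_mul 1, hpqp]
      simp
    rw [h2] at h1
    refine le_antisymm ?_ ?_
    · simpa [Matrix.mul_assoc] using h1
    · rw [Matrix.nonneg_iff_posSemidef]
      exact posSemidef_self_mul_conjTranspose _
  have hpa : p * q * a = a := by
    rw [Matrix.sub_mul, Matrix.one_mul, sub_eq_zero] at hz
    exact hz.symm
  refine ⟨q * a, ?_, ?_, fun he => ?_⟩
  · refine le_trans ?_ hle1
    have h1 := mul_mul_conjTranspose_mono h q
    have h2 : q * (p * p) * qᴴ = p * q := by
      rw [hqsa, ← Matrix.mul_assoc, hcomm, Matrix.mul_assoc, hproj]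
    rw [h2] at h1
    simpa [Matrix.mul_assoc] using h1
  · rw [← Matrix.mul_assoc, hpa]
  · rw [conjTranspose_mul, hqsa, ← Matrix.mul_assoc, he, Matrix.mul_assoc, ← hcomm,
      ← Matrix.mul_assoc, hpqp]

theorem sqrt_posSemidef (ρ : Matrix X X ℂ) : (CFC.sqrt ρ).PosSemidef :=
  Matrix.nonneg_iff_posSemidef.1 (CFC.sqrt_nonneg ρ)

theorem sqrt_mul_sqrt {ρ : Matrix X X ℂ} (h : ρ.PosSemidef) :
    CFC.sqrt ρ * CFC.sqrt ρ = ρ :=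
  CFC.sqrt_mul_sqrt_self ρ h.nonneg

theorem sqrt_conjTranspose (ρ : Matrix X X ℂ) : (CFC.sqrt ρ)ᴴ = CFC.sqrt ρ :=
  (sqrt_posSemidef ρ).1

theorem exists_contraction_of_le_posSemidef {ρ : Matrix X X ℂ} (hρ : ρ.PosSemidef)
    {a : Matrix X Y ℂ} (h : a * aᴴ ≤ ρ) :
    ∃ K : Matrix X Y ℂ, K * Kᴴ ≤ 1 ∧ a = CFC.sqrt ρ * K ∧
      (a * aᴴ = ρ → a * Kᴴ = CFC.sqrt ρ) := by
  have := exists_contraction_of_le (sqrt_posSemidef ρ) (a := a) (by rwa [sqrt_mul_sqrt hρ])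
  rwa [sqrt_mul_sqrt hρ] at this

/-- With `s = √p`, expand `0 ≤ Tr (s - sK)(s - sK)ᴴ = Tr p - 2 Re Tr (pK) + Tr (s K Kᴴ s)`; the last
term is at most `Tr p`. -/
theorem trace_mul_contraction_re_le {p : Matrix X X ℂ} (hp : p.PosSemidef) {K : Matrix X X ℂ}
    (hK : K * Kᴴ ≤ 1) : (p * K).trace.re ≤ p.trace.re := by
  set s := CFC.sqrt p
  have hs : sᴴ = s := sqrt_conjTranspose p
  have hss : s * s = p := sqrt_mul_sqrt hp
  have h0 := (Complex.le_def.1 (posSemidef_self_mul_conjTranspose (s - s * K)).trace_nonneg).1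
  have h1 := trace_re_mono (mul_mul_conjTranspose_mono hK s)
  have e2 : (s * (s * K)ᴴ).trace = star ((p * K).trace) := by
    rw [← trace_conjTranspose, conjTranspose_mul, conjTranspose_mul, hs, hp.1.eq, ← hss,
      trace_mul_comm, Matrix.mul_assoc]
  have e3 : (s * K * s).trace = (p * K).trace := by
    rw [trace_mul_comm, ← Matrix.mul_assoc, hss]
  rw [conjTranspose_sub, Matrix.mul_sub, Matrix.sub_mul, Matrix.sub_mul] at h0
  simp only [trace_sub, e2, e3, hs, hss] at h0
  simp only [Matrix.mul_one, hs, hss] at h1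
  have e4 : (s * K * (s * K)ᴴ).trace = (s * (K * Kᴴ) * s).trace := by
    rw [conjTranspose_mul, hs]; simp only [Matrix.mul_assoc]
  rw [e4] at h0
  simp at h0
  linarith

end Contractions

/-! ### Fidelity, Uhlmann's theorem and the triangle inequality -/

section Fidelity

variable {X Y Z : Type*} [Fintype X] [DecidableEq X] [Fintype Y] [DecidableEq Y]
  [Fintype Z] [DecidableEq Z]

/-- Write `a = √ρ K`, `b = √σ L` and `√ρ √σ = p U` with `p = √(N Nᴴ)`. The trace becomes `Tr (p K Lᴴ
Uᴴ)`, a positive operator times a contraction, and `Tr p` is the fidelity. Every monotonicity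
property of the fidelity is deduced from this bound. -/
theorem re_trace_mul_conjTranspose_le_fidelity {ρ σ : Matrix X X ℂ} (hρ : ρ.PosSemidef)
    (hσ : σ.PosSemidef) {a b : Matrix X Y ℂ} (ha : a * aᴴ ≤ ρ) (hb : b * bᴴ ≤ σ) :
    (a * bᴴ).trace.re ≤ fidelity ρ σ := by
  obtain ⟨K, hK, rfl, -⟩ := exists_contraction_of_le_posSemidef hρ ha
  obtain ⟨L, hL, rfl, -⟩ := exists_contraction_of_le_posSemidef hσ hb
  set N := CFC.sqrt ρ * CFC.sqrt σ with hN
  obtain ⟨U, hU, hNU, -⟩ :=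
    exists_contraction_of_le_posSemidef (posSemidef_self_mul_conjTranspose N) (a := N) le_rfl
  set p := CFC.sqrt (N * Nᴴ) with hp
  have hpp : p.PosSemidef := sqrt_posSemidef _
  have hU' : Uᴴ * Uᴴᴴ ≤ 1 := by simpa using conjTranspose_mul_self_le_one hU
  have hL' : Lᴴ * Lᴴᴴ ≤ 1 := by simpa using conjTranspose_mul_self_le_one hL
  have key := trace_mul_contraction_re_le hpp (contraction_mul (contraction_mul hK hL') hU')
  have : (CFC.sqrt ρ * K * (CFC.sqrt σ * L)ᴴ).trace = (p * (K * Lᴴ * Uᴴ)).trace := by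
    have h1 : CFC.sqrt σ * CFC.sqrt ρ = Uᴴ * p := by
      have := congrArg conjTranspose hNU
      rwa [hN, conjTranspose_mul, conjTranspose_mul, sqrt_conjTranspose, sqrt_conjTranspose,
        hpp.1.eq] at this
    rw [conjTranspose_mul, sqrt_conjTranspose, Matrix.mul_assoc, trace_mul_comm,
      ← Matrix.mul_assoc, Matrix.mul_assoc _ (CFC.sqrt σ), h1, trace_mul_comm p]
    simp only [Matrix.mul_assoc]
  rw [this]
  exact key

/-- Uhlmann's theorem: the fidelity is attained at every factorization of one of the states. -/
theorem exists_contraction_trace_eq_fidelity (ρ : Matrix X X ℂ) {σ : Matrix X X ℂ}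
    (hσ : σ.PosSemidef) {b : Matrix X Y ℂ} (hb : b * bᴴ = σ) :
    ∃ K : Matrix X Y ℂ, K * Kᴴ ≤ 1 ∧
      (CFC.sqrt ρ * K * bᴴ).trace = (fidelity ρ σ : ℂ) := by
  obtain ⟨V, hV, -, hbV⟩ := exists_contraction_of_le_posSemidef hσ hb.le
  replace hbV := hbV hb
  set N := CFC.sqrt ρ * CFC.sqrt σ with hN
  obtain ⟨U, hU, -, hNU⟩ :=
    exists_contraction_of_le_posSemidef (posSemidef_self_mul_conjTranspose N) (a := N) le_rfl
  replace hNU := hNU rfl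
  have hU' : Uᴴ * Uᴴᴴ ≤ 1 := by simpa using conjTranspose_mul_self_le_one hU
  -- `U` is the polar factor of `√ρ √σ` and `V` that of `b`: `V bᴴ = √σ` leaves `Tr (√ρ U √σ)`, the
  -- conjugate of `Tr (N Uᴴ) = Tr √(N Nᴴ)`.
  refine ⟨U * V, contraction_mul hU hV, ?_⟩
  have hVb : V * bᴴ = CFC.sqrt σ := by
    have := congrArg conjTranspose hbV
    rwa [conjTranspose_mul, conjTranspose_conjTranspose, sqrt_conjTranspose] at this
  have h1 : (CFC.sqrt ρ * (U * V) * bᴴ).trace = star ((N * Uᴴ).trace) := by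
    rw [← trace_conjTranspose, conjTranspose_mul, conjTranspose_conjTranspose, hN,
      conjTranspose_mul, sqrt_conjTranspose, sqrt_conjTranspose, Matrix.mul_assoc,
      Matrix.mul_assoc, hVb, trace_mul_comm, Matrix.mul_assoc]
  rw [h1, hNU, ← trace_conjTranspose, sqrt_conjTranspose]
  exact posSemidef_trace_eq_re (sqrt_posSemidef _)

theorem fidelity_nonneg (ρ σ : Matrix X X ℂ) : 0 ≤ fidelity ρ σ :=
  (Complex.le_def.1 (sqrt_posSemidef _).trace_nonneg).1

theorem mul_contraction_le {ρ : Matrix X X ℂ} (hρ : ρ.PosSemidef) {K : Matrix X Y ℂ}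
    (hK : K * Kᴴ ≤ 1) : CFC.sqrt ρ * K * (CFC.sqrt ρ * K)ᴴ ≤ ρ := by
  have := mul_mul_conjTranspose_mono hK (CFC.sqrt ρ)
  rw [Matrix.mul_one, sqrt_conjTranspose, sqrt_mul_sqrt hρ] at this
  simpa [Matrix.mul_assoc, sqrt_conjTranspose] using this

/-- The fidelity is attained by factors `a aᴴ ≤ ρ`, `b bᴴ = σ`, for any prescribed `b`. -/
theorem exists_trace_eq_fidelity {ρ σ : Matrix X X ℂ} (hρ : ρ.PosSemidef)
    (hσ : σ.PosSemidef) {b : Matrix X Y ℂ} (hb : b * bᴴ = σ) :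
    ∃ a : Matrix X Y ℂ, a * aᴴ ≤ ρ ∧ (a * bᴴ).trace = (fidelity ρ σ : ℂ) := by
  obtain ⟨K, hK, h⟩ := exists_contraction_trace_eq_fidelity ρ hσ hb
  exact ⟨_, mul_contraction_le hρ hK, h⟩

theorem exists_mul_conjTranspose_eq {ρ : Matrix X X ℂ} (hρ : ρ.PosSemidef) :
    ∃ b : Matrix X X ℂ, b * bᴴ = ρ :=
  ⟨CFC.sqrt ρ, by rw [sqrt_conjTranspose, sqrt_mul_sqrt hρ]⟩

theorem fidelity_comm_le {ρ σ : Matrix X X ℂ} (hρ : ρ.PosSemidef) (hσ : σ.PosSemidef) :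
    fidelity ρ σ ≤ fidelity σ ρ := by
  obtain ⟨b, hb⟩ := exists_mul_conjTranspose_eq hσ
  obtain ⟨a, ha, h⟩ := exists_trace_eq_fidelity hρ hσ hb
  have := re_trace_mul_conjTranspose_le_fidelity hσ hρ hb.le ha
  have e : (b * aᴴ).trace = star (a * bᴴ).trace := by
    rw [← trace_conjTranspose]; simp
  rw [e, h] at this
  simpa using this

theorem fidelity_comm {ρ σ : Matrix X X ℂ} (hρ : ρ.PosSemidef) (hσ : σ.PosSemidef) :
    fidelity ρ σ = fidelity σ ρ :=
  le_antisymm (fidelity_comm_le hρ hσ) (fidelity_comm_le hσ hρ)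

theorem fidelity_self {ρ : Matrix X X ℂ} (hρ : ρ.PosSemidef) :
    ρ.trace.re ≤ fidelity ρ ρ := by
  obtain ⟨b, hb⟩ := exists_mul_conjTranspose_eq hρ
  have := re_trace_mul_conjTranspose_le_fidelity hρ hρ hb.le hb.le
  rwa [hb] at this

/-- The rows of a matrix, as one vector. -/
def toVec (a : Matrix X Y ℂ) : EuclideanSpace ℂ (X × Y) :=
  WithLp.toLp 2 fun p => a p.1 p.2

theorem inner_toVec (a b : Matrix X Y ℂ) : inner ℂ (toVec b) (toVec a) = (a * bᴴ).trace := by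
  simp [toVec, Matrix.trace, Matrix.mul_apply, PiLp.inner_apply, Fintype.sum_prod_type]

theorem norm_toVec_sq (a : Matrix X Y ℂ) : ‖toVec a‖ ^ 2 = (a * aᴴ).trace.re := by
  rw [← inner_toVec, ← inner_self_eq_norm_sq (𝕜 := ℂ)]
  rfl

/-- The triangle inequality for the angle between unit vectors. -/
theorem mul_sub_sqrt_mul_sqrt_le_inner {E : Type*} [NormedAddCommGroup E] [InnerProductSpace ℂ E]
    {a b c : E} (hb : ‖b‖ = 1) (ha : ‖a‖ ≤ 1) (hc : ‖c‖ ≤ 1) {f g : ℝ}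
    (hf : inner ℂ b a = (f : ℂ)) (hg : inner ℂ c b = (g : ℂ)) :
    f * g - √(1 - f ^ 2) * √(1 - g ^ 2) ≤ (inner ℂ c a : ℂ).re := by
  have hf' : inner ℂ a b = (f : ℂ) := by rw [← inner_conj_symm, hf]; simp
  have hg' : inner ℂ b c = (g : ℂ) := by rw [← inner_conj_symm, hg]; simp
  have hbb : inner ℂ b b = (1 : ℂ) := by simp [inner_self_eq_norm_sq_to_K, hb]
  have haa : inner ℂ a a = ((‖a‖ ^ 2 : ℝ) : ℂ) := by simp [inner_self_eq_norm_sq_to_K]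
  have hcc : inner ℂ c c = ((‖c‖ ^ 2 : ℝ) : ℂ) := by simp [inner_self_eq_norm_sq_to_K]
  -- Cauchy–Schwarz will be applied to the components of `a` and `c` orthogonal to `b`.
  have h1 : ‖a - (f : ℂ) • b‖ ^ 2 = ‖a‖ ^ 2 - f ^ 2 := by
    rw [← inner_self_eq_norm_sq (𝕜 := ℂ)]
    simp only [inner_sub_left, inner_sub_right, inner_smul_left, inner_smul_right, hf, hf', hbb,
      haa, Complex.conj_ofReal]
    simp
    rw [← Complex.ofReal_pow, Complex.ofReal_re]; ring
  have h2 : ‖c - (g : ℂ) • b‖ ^ 2 = ‖c‖ ^ 2 - g ^ 2 := by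
    rw [← inner_self_eq_norm_sq (𝕜 := ℂ)]
    simp only [inner_sub_left, inner_sub_right, inner_smul_left, inner_smul_right, hg, hg', hbb,
      hcc, Complex.conj_ofReal]
    simp
    rw [← Complex.ofReal_pow, Complex.ofReal_re]; ring
  have h3 : (inner ℂ (c - (g : ℂ) • b) (a - (f : ℂ) • b) : ℂ).re
      = (inner ℂ c a : ℂ).re - f * g := by
    simp only [inner_sub_left, inner_sub_right, inner_smul_left, inner_smul_right, hf, hg, hbb,
      Complex.conj_ofReal]
    simp
    ring
  have h4 : ‖a - (f : ℂ) • b‖ ≤ √(1 - f ^ 2) := by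
    apply Real.le_sqrt_of_sq_le
    rw [h1]; nlinarith [norm_nonneg a]
  have h5 : ‖c - (g : ℂ) • b‖ ≤ √(1 - g ^ 2) := by
    apply Real.le_sqrt_of_sq_le
    rw [h2]; nlinarith [norm_nonneg c]
  have h6 : |(inner ℂ (c - (g : ℂ) • b) (a - (f : ℂ) • b) : ℂ).re| ≤
      √(1 - g ^ 2) * √(1 - f ^ 2) :=
    (Complex.abs_re_le_norm _).trans ((norm_inner_le_norm _ _).trans
      (mul_le_mul h5 h4 (norm_nonneg _) (Real.sqrt_nonneg _)))
  rw [h3] at h6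
  have := neg_abs_le ((inner ℂ c a : ℂ).re - f * g)
  nlinarith

/-- One factor `b` of the middle state serves both optimal overlaps, so the claim reduces to three
vectors. Normalization of `σ` makes `b` a unit vector; the outer states may be sub-normalized. -/
theorem fidelity_triangle {ρ σ ω : Matrix X X ℂ} (hρ : ρ ∈ subStates X) (hσ : σ ∈ states X)
    (hω : ω ∈ subStates X) :
    fidelity ρ σ * fidelity σ ω -
      √(1 - fidelity ρ σ ^ 2) * √(1 - fidelity σ ω ^ 2) ≤ fidelity ρ ω := by
  obtain ⟨b, hb⟩ := exists_mul_conjTranspose_eq hσ.1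
  obtain ⟨a, ha, hae⟩ := exists_trace_eq_fidelity hρ.1 hσ.1 hb
  obtain ⟨c, hc, hce⟩ := exists_trace_eq_fidelity hω.1 hσ.1 hb
  rw [fidelity_comm hω.1 hσ.1] at hce
  have key := mul_sub_sqrt_mul_sqrt_le_inner (a := toVec a) (b := toVec b) (c := toVec c)
    (f := fidelity ρ σ) (g := fidelity σ ω) ?_ ?_ ?_ ?_ ?_
  · rw [inner_toVec] at key
    exact key.trans (re_trace_mul_conjTranspose_le_fidelity hρ.1 hω.1 ha hc)
  · have := norm_toVec_sq b
    rw [hb, hσ.2, Complex.one_re] at this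
    nlinarith [norm_nonneg (toVec b)]
  · have := norm_toVec_sq a
    have := trace_re_mono ha
    have := hρ.2
    nlinarith [norm_nonneg (toVec a)]
  · have := norm_toVec_sq c
    have := trace_re_mono hc
    have := hω.2
    nlinarith [norm_nonneg (toVec c)]
  · rw [inner_toVec, hae]
  · rw [← inner_conj_symm, inner_toVec, hce]; simp

/-- Cauchy–Schwarz for an optimal pair of factors. It keeps the trace away from zero on a smoothing
ball of radius less than `1`. -/
theorem fidelity_sq_le_trace {ρ σ : Matrix X X ℂ} (hρ : ρ.PosSemidef) (hσ : σ ∈ states X) :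
    fidelity ρ σ ^ 2 ≤ ρ.trace.re := by
  obtain ⟨b, hb⟩ := exists_mul_conjTranspose_eq hσ.1
  obtain ⟨a, ha, hae⟩ := exists_trace_eq_fidelity hρ hσ.1 hb
  have h1 := norm_inner_le_norm (𝕜 := ℂ) (toVec b) (toVec a)
  rw [inner_toVec, hae, Complex.norm_real, Real.norm_of_nonneg (fidelity_nonneg _ _)] at h1
  have h2 := norm_toVec_sq b
  rw [hb, hσ.2, Complex.one_re] at h2
  have h3 := norm_toVec_sq a
  have h4 := trace_re_mono ha
  have h5 := fidelity_nonneg ρ σ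
  have h6 : ‖toVec b‖ = 1 := by nlinarith [norm_nonneg (toVec b)]
  rw [h6, one_mul] at h1
  nlinarith

/-- A normalized first argument kills the correction term of the generalized fidelity. -/
theorem purifiedDist_le_iff {ρ σ : Matrix X X ℂ} (hρ : ρ ∈ states X) {ε : ℝ} (hε : 0 ≤ ε) :
    purifiedDist ρ σ ≤ ε ↔ 1 - ε ^ 2 ≤ fidelity ρ σ ^ 2 := by
  rw [purifiedDist, genFidelity, hρ.2, Real.sqrt_le_left hε]
  simp
  constructor <;> intro h <;> linarith

theorem one_sub_sq_le_fidelity_sq_triangle {ρ σ ω : Matrix X X ℂ} (hρ : ρ ∈ subStates X)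
    (hσ : σ ∈ states X) (hω : ω ∈ subStates X) {ε₁ ε₂ : ℝ} (h₁ : 0 ≤ ε₁) (h₂ : 0 ≤ ε₂)
    (h : ε₁ + ε₂ ≤ 1) (hf : 1 - ε₁ ^ 2 ≤ fidelity ρ σ ^ 2) (hg : 1 - ε₂ ^ 2 ≤ fidelity σ ω ^ 2) :
    1 - (ε₁ + ε₂) ^ 2 ≤ fidelity ρ ω ^ 2 := by
  have key := fidelity_triangle hρ hσ hω
  set f := fidelity ρ σ
  set g := fidelity σ ω
  have hf0 : 0 ≤ f := fidelity_nonneg _ _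
  have hg0 : 0 ≤ g := fidelity_nonneg _ _
  have e1 : √(1 - f ^ 2) ≤ ε₁ := by rw [Real.sqrt_le_left h₁]; linarith
  have e2 : √(1 - g ^ 2) ≤ ε₂ := by rw [Real.sqrt_le_left h₂]; linarith
  have e3 : √(1 - f ^ 2) * √(1 - g ^ 2) ≤ ε₁ * ε₂ :=
    mul_le_mul e1 e2 (Real.sqrt_nonneg _) h₁
  set s := √((1 - ε₁ ^ 2) * (1 - ε₂ ^ 2))
  have p1 : 0 ≤ 1 - ε₁ ^ 2 := by nlinarith
  have p2 : 0 ≤ 1 - ε₂ ^ 2 := by nlinarith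
  have hs2 : s ^ 2 = (1 - ε₁ ^ 2) * (1 - ε₂ ^ 2) := Real.sq_sqrt (mul_nonneg p1 p2)
  have hs0 : 0 ≤ s := Real.sqrt_nonneg _
  have hs : s ≤ f * g := by
    apply Real.sqrt_le_iff.2 ⟨mul_nonneg hf0 hg0, ?_⟩
    rw [mul_pow]
    exact mul_le_mul hf hg p2 (sq_nonneg _)
  have hs1 : s ≤ 1 := by
    apply Real.sqrt_le_iff.2 ⟨zero_le_one, ?_⟩
    nlinarith [sq_nonneg ε₁, sq_nonneg ε₂]
  have hse : ε₁ * ε₂ ≤ s := by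
    apply Real.le_sqrt_of_sq_le
    nlinarith [mul_nonneg h₁ h₂]
  have hfin : s - ε₁ * ε₂ ≤ fidelity ρ ω := by linarith
  have h7 : (s - ε₁ * ε₂) ^ 2 ≤ fidelity ρ ω ^ 2 :=
    pow_le_pow_left₀ (by linarith) hfin 2
  have h8 := mul_nonneg h₁ h₂
  -- With `e = ε₁ ε₂`, `(s - e)²` exceeds `1 - (ε₁ + ε₂)²` by `2e(1 - s) + 2e²`.
  nlinarith [mul_nonneg h8 (sub_nonneg.2 hs1), mul_nonneg h8 h8]

end Fidelity

/-! ### Monotonicity of the fidelity and extension of nearby states -/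

section Monotonicity

variable {X Y Z : Type*} [Fintype X] [DecidableEq X] [Fintype Y] [DecidableEq Y]
  [Fintype Z] [DecidableEq Z]

theorem submatrix_mono {A B : Matrix X X ℂ} (h : A ≤ B) (e : Y → X) :
    A.submatrix e e ≤ B.submatrix e e := by
  rw [Matrix.le_iff] at h ⊢
  exact h.submatrix e

theorem trace_submatrix_equiv (A : Matrix X X ℂ) (e : Y ≃ X) :
    (A.submatrix e e).trace = A.trace :=
  Equiv.sum_comp e fun x => A x x

theorem submatrix_mem_states {ρ : Matrix X X ℂ} (h : ρ ∈ states X) (e : Y ≃ X) :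
    ρ.submatrix e e ∈ states Y :=
  ⟨h.1.submatrix e, (trace_submatrix_equiv ρ e).trans h.2⟩

/-- An optimal pair of factors is transported to factors of the images with the same overlap. The
partial trace, channels and tensoring with a state are treated in the same way below. -/
theorem fidelity_le_submatrix {ρ σ : Matrix X X ℂ} (hρ : ρ.PosSemidef) (hσ : σ.PosSemidef)
    (e : Y ≃ X) : fidelity ρ σ ≤ fidelity (ρ.submatrix e e) (σ.submatrix e e) := by
  obtain ⟨b, hb⟩ := exists_mul_conjTranspose_eq hσ
  obtain ⟨a, ha, h⟩ := exists_trace_eq_fidelity hρ hσ hb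
  have hm : ∀ c d : Matrix X X ℂ,
      c.submatrix e id * (d.submatrix e id)ᴴ = (c * dᴴ).submatrix e e := fun _ _ => rfl
  have key := re_trace_mul_conjTranspose_le_fidelity (hρ.submatrix e) (hσ.submatrix e)
    (a := a.submatrix e id) (b := b.submatrix e id) ?_ ?_
  · rw [hm, trace_submatrix_equiv, h] at key
    simpa using key
  · rw [hm]
    exact submatrix_mono ha e
  · rw [hm]
    exact submatrix_mono hb.le e

theorem traceSnd_eq_sum (M : Matrix (X × Y) (X × Y) ℂ) :
    traceSnd M = ∑ y, M.submatrix (·, y) (·, y) := by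
  ext x x'
  simp [traceSnd, Matrix.sum_apply]

theorem traceSnd_posSemidef {M : Matrix (X × Y) (X × Y) ℂ} (h : M.PosSemidef) :
    (traceSnd M).PosSemidef := by
  rw [traceSnd_eq_sum]
  exact posSemidef_sum _ fun y _ => h.submatrix _

theorem traceSnd_sub (M N : Matrix (X × Y) (X × Y) ℂ) :
    traceSnd (M - N) = traceSnd M - traceSnd N := by
  ext x x'
  simp [traceSnd]

theorem traceSnd_add (M N : Matrix (X × Y) (X × Y) ℂ) :
    traceSnd (M + N) = traceSnd M + traceSnd N := by
  ext x x'
  simp [traceSnd, Finset.sum_add_distrib]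

theorem traceSnd_mono {M N : Matrix (X × Y) (X × Y) ℂ} (h : M ≤ N) :
    traceSnd M ≤ traceSnd N := by
  rw [Matrix.le_iff] at h ⊢
  rw [← traceSnd_sub]
  exact traceSnd_posSemidef h

theorem trace_traceSnd (M : Matrix (X × Y) (X × Y) ℂ) : (traceSnd M).trace = M.trace := by
  simp [Matrix.trace, traceSnd, Fintype.sum_prod_type]

theorem traceSnd_kronecker (M : Matrix X X ℂ) (N : Matrix Y Y ℂ) :
    traceSnd (M ⊗ₖ N) = N.trace • M := by
  ext x x'
  simp [traceSnd, Matrix.trace, ← Finset.mul_sum, mul_comm]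

/-- Moves the middle index of a factor to the columns. -/
def shift (a : Matrix (X × Y) Z ℂ) : Matrix X (Y × Z) ℂ := Matrix.of fun x p => a (x, p.1) p.2

/-- The inverse of `shift`. -/
def unshift (a : Matrix X (Y × Z) ℂ) : Matrix (X × Y) Z ℂ := Matrix.of fun p z => a p.1 (p.2, z)

theorem shift_mul_conjTranspose (a b : Matrix (X × Y) Z ℂ) :
    shift a * (shift b)ᴴ = traceSnd (a * bᴴ) := by
  ext x x'
  simp [shift, traceSnd, Matrix.mul_apply, Fintype.sum_prod_type]

theorem fidelity_le_traceSnd {ρ σ : Matrix (X × Y) (X × Y) ℂ} (hρ : ρ.PosSemidef)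
    (hσ : σ.PosSemidef) : fidelity ρ σ ≤ fidelity (traceSnd ρ) (traceSnd σ) := by
  obtain ⟨b, hb⟩ := exists_mul_conjTranspose_eq hσ
  obtain ⟨a, ha, h⟩ := exists_trace_eq_fidelity hρ hσ hb
  have key := re_trace_mul_conjTranspose_le_fidelity (traceSnd_posSemidef hρ)
    (traceSnd_posSemidef hσ) (a := shift a) (b := shift b) ?_ ?_
  · rw [shift_mul_conjTranspose, trace_traceSnd, h] at key
    simpa using key
  · rw [shift_mul_conjTranspose]
    exact traceSnd_mono ha
  · rw [shift_mul_conjTranspose]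
    exact traceSnd_mono hb.le

theorem tensorId_posSemidef {Φ : Matrix X X ℂ →ₗ[ℂ] Matrix Y Y ℂ} (hΦ : IsChannel Φ)
    {M : Matrix (X × Z) (X × Z) ℂ} (hM : M.PosSemidef) : (tensorId Z Φ M).PosSemidef := by
  let e := Fintype.equivFin Z
  have h := (hΦ.1 _ _ (hM.submatrix fun p : X × Fin (Fintype.card Z) => (p.1, e.symm p.2))).submatrix
    fun p : Y × Z => (p.1, e p.2)
  convert h using 1
  ext p p'
  simp [tensorId]

theorem tensorId_mono {Φ : Matrix X X ℂ →ₗ[ℂ] Matrix Y Y ℂ} (hΦ : IsChannel Φ)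
    {M N : Matrix (X × Z) (X × Z) ℂ} (h : M ≤ N) : tensorId Z Φ M ≤ tensorId Z Φ N := by
  rw [Matrix.le_iff] at h ⊢
  rw [← map_sub]
  exact tensorId_posSemidef hΦ h

theorem trace_tensorId {Φ : Matrix X X ℂ →ₗ[ℂ] Matrix Y Y ℂ} (hΦ : IsChannel Φ)
    (M : Matrix (X × Z) (X × Z) ℂ) : (tensorId Z Φ M).trace = M.trace := by
  have : ∀ z, ∑ y, Φ (Matrix.of fun x x' => M (x, z) (x', z)) y y = ∑ x, M (x, z) (x, z) :=
    fun z => hΦ.2 _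
  simp only [Matrix.trace, Fintype.sum_prod_type_right, tensorId, Matrix.diag_apply]
  exact Finset.sum_congr rfl fun z _ => this z

theorem tensorId_mem_subStates {Φ : Matrix X X ℂ →ₗ[ℂ] Matrix Y Y ℂ} (hΦ : IsChannel Φ)
    {M : Matrix (X × Z) (X × Z) ℂ} (hM : M ∈ subStates (X × Z)) :
    tensorId Z Φ M ∈ subStates (Y × Z) :=
  ⟨tensorId_posSemidef hΦ hM.1, by rw [trace_tensorId hΦ]; exact hM.2⟩

/-- Complete positivity with one extra qubit suffices, without Kraus operators. Stack `a` and `b`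
into `G`; the channel applied to `G Gᴴ` is positive, and block rows of a factor of it satisfy `c i
(c j)ᴴ = Φ(aᵢ aⱼᴴ)`. Trace preservation then keeps the overlap. -/
theorem fidelity_le_tensorId {Φ : Matrix X X ℂ →ₗ[ℂ] Matrix Y Y ℂ} (hΦ : IsChannel Φ)
    {ρ σ : Matrix (X × Z) (X × Z) ℂ} (hρ : ρ.PosSemidef) (hσ : σ.PosSemidef) :
    fidelity ρ σ ≤ fidelity (tensorId Z Φ ρ) (tensorId Z Φ σ) := by
  obtain ⟨b, hb⟩ := exists_mul_conjTranspose_eq hσ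
  obtain ⟨a, ha, h⟩ := exists_trace_eq_fidelity hρ hσ hb
  let G : Matrix (X × (Z × Fin 2)) (X × Z) ℂ := Matrix.of fun p w => ![a, b] p.2.2 (p.1, p.2.1) w
  obtain ⟨G', hG'⟩ := exists_mul_conjTranspose_eq
    (tensorId_posSemidef (Z := Z × Fin 2) hΦ (posSemidef_self_mul_conjTranspose G))
  let c : Fin 2 → Matrix (Y × Z) (Y × (Z × Fin 2)) ℂ := fun i =>
    Matrix.of fun p w => G' (p.1, (p.2, i)) w
  have hc : ∀ i j, c i * (c j)ᴴ = tensorId Z Φ (![a, b] i * (![a, b] j)ᴴ) := by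
    intro i j
    ext p p'
    have := congrFun (congrFun hG' (p.1, (p.2, i))) (p'.1, (p'.2, j))
    simpa [Matrix.mul_apply, c, G, tensorId] using this
  have key := re_trace_mul_conjTranspose_le_fidelity (tensorId_posSemidef hΦ hρ)
    (tensorId_posSemidef hΦ hσ) (a := c 0) (b := c 1) ?_ ?_
  · rw [hc, trace_tensorId hΦ] at key
    simpa [h] using key
  · rw [hc]
    exact tensorId_mono hΦ ha
  · rw [hc]
    exact tensorId_mono hΦ hb.le

theorem kronecker_mono_right {P : Matrix X X ℂ} (hP : P.PosSemidef) {A B : Matrix Y Y ℂ}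
    (h : A ≤ B) : P ⊗ₖ A ≤ P ⊗ₖ B := by
  rw [Matrix.le_iff] at h ⊢
  convert hP.kronecker h using 1
  ext i j
  simp [mul_sub]

theorem kronecker_mono_left {P : Matrix X X ℂ} (hP : P.PosSemidef) {A B : Matrix Y Y ℂ}
    (h : A ≤ B) : A ⊗ₖ P ≤ B ⊗ₖ P := by
  rw [Matrix.le_iff] at h ⊢
  convert h.kronecker hP using 1
  ext i j
  simp [sub_mul]

theorem kronecker_mem_states {ρ : Matrix X X ℂ} {σ : Matrix Y Y ℂ} (hρ : ρ ∈ states X)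
    (hσ : σ ∈ states Y) : ρ ⊗ₖ σ ∈ states (X × Y) :=
  ⟨hρ.1.kronecker hσ.1, by rw [trace_kronecker, hρ.2, hσ.2, one_mul]⟩

theorem kronecker_mem_subStates {ρ : Matrix X X ℂ} {σ : Matrix Y Y ℂ} (hρ : ρ ∈ states X)
    (hσ : σ ∈ subStates Y) : ρ ⊗ₖ σ ∈ subStates (X × Y) :=
  ⟨hρ.1.kronecker hσ.1, by rw [trace_kronecker, hρ.2, one_mul]; exact hσ.2⟩

theorem states_subset_subStates : states X ⊆ subStates X :=
  fun _ h => ⟨h.1, by rw [h.2]; simp⟩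

theorem fidelity_le_kronecker {P : Matrix X X ℂ} (hP : P ∈ states X) {ρ σ : Matrix Y Y ℂ}
    (hρ : ρ.PosSemidef) (hσ : σ.PosSemidef) :
    fidelity ρ σ ≤ fidelity (P ⊗ₖ ρ) (P ⊗ₖ σ) := by
  obtain ⟨b, hb⟩ := exists_mul_conjTranspose_eq hσ
  obtain ⟨g, hg⟩ := exists_mul_conjTranspose_eq hP.1
  obtain ⟨a, ha, h⟩ := exists_trace_eq_fidelity hρ hσ hb
  have key := re_trace_mul_conjTranspose_le_fidelity (hP.1.kronecker hρ) (hP.1.kronecker hσ)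
    (a := g ⊗ₖ a) (b := g ⊗ₖ b) ?_ ?_
  · rw [conjTranspose_kronecker, ← mul_kronecker_mul, trace_kronecker, hg, hP.2, one_mul, h] at key
    simpa using key
  · rw [conjTranspose_kronecker, ← mul_kronecker_mul, hg]
    exact kronecker_mono_right hP.1 ha
  · rw [conjTranspose_kronecker, ← mul_kronecker_mul, hg, hb]

theorem single_mem_states (x : X) : Matrix.single x x (1 : ℂ) ∈ states X := by
  refine ⟨?_, by simp⟩
  rw [← Matrix.diagonal_single, Matrix.posSemidef_diagonal_iff]
  intro i
  by_cases h : i = x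
  · subst h; simp
  · simp [h]

/-- A positive semidefinite `t` on `X` extends to `X ⊗ Y`, at least as close to a given `ω` as `t` is to the marginal of `ω`. -/
theorem exists_extension_fidelity_le [Nonempty Y] {ω : Matrix (X × Y) (X × Y) ℂ}
    (hω : ω.PosSemidef) {t : Matrix X X ℂ} (ht : t.PosSemidef) :
    ∃ T : Matrix (X × Y) (X × Y) ℂ, T.PosSemidef ∧ traceSnd T = t ∧
      fidelity (traceSnd ω) t ≤ fidelity ω T := by
  obtain ⟨a, ha⟩ := exists_mul_conjTranspose_eq hω
  obtain ⟨c, hc, h⟩ := exists_trace_eq_fidelity ht (traceSnd_posSemidef hω) (b := shift a)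
    (by rw [shift_mul_conjTranspose, ha])
  have hcc : shift (unshift c) = c := rfl
  have hct : traceSnd (unshift c * (unshift c)ᴴ) ≤ t := by
    rwa [← shift_mul_conjTranspose, hcc]
  have hs := single_mem_states (Classical.arbitrary Y)
  set s := Matrix.single (Classical.arbitrary Y) (Classical.arbitrary Y) (1 : ℂ)
  -- The Uhlmann factor only has marginal below `t`. The positive deficit is put back, tensored with
  -- a fixed state of `Y`; this cannot spoil the overlap bound, since factors need only satisfy an
  -- inequality.
  have hrest := (Matrix.le_iff.1 hct).kronecker hs.1
  have hT := (posSemidef_self_mul_conjTranspose (unshift c)).add hrest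
  refine ⟨_, hT, ?_, ?_⟩
  · rw [traceSnd_add, traceSnd_kronecker, hs.2, one_smul, add_sub_cancel]
  · have hle : unshift c * (unshift c)ᴴ ≤ unshift c * (unshift c)ᴴ +
        (t - traceSnd (unshift c * (unshift c)ᴴ)) ⊗ₖ s := by
      rw [Matrix.le_iff, add_sub_cancel_left]
      exact hrest
    have key := re_trace_mul_conjTranspose_le_fidelity hT hω hle ha.le
    rw [← trace_traceSnd, ← shift_mul_conjTranspose, hcc, h, Complex.ofReal_re] at key
    rw [fidelity_comm (traceSnd_posSemidef hω) ht, fidelity_comm hω hT]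
    exact key

end Monotonicity

/-! ### The dimension bound and channels on tensor products -/

section Blocks

variable {X Y Z W : Type*} [Fintype X] [DecidableEq X] [Fintype Y] [DecidableEq Y]
  [Fintype Z] [DecidableEq Z] [Fintype W] [DecidableEq W]

/-- The partial trace over the first factor. -/
def traceFst (M : Matrix (X × Y) (X × Y) ℂ) : Matrix Y Y ℂ :=
  Matrix.of fun y y' => ∑ x, M (x, y) (x, y')

theorem smul_mono {A B : Matrix X X ℂ} (h : A ≤ B) {c : ℝ} (hc : 0 ≤ c) : c • A ≤ c • B := by
  rw [Matrix.le_iff] at h ⊢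
  rw [← smul_sub]
  exact h.smul hc

/-- The difference of the two sides is half the sum of all `(a i - a j)(a i - a j)ᴴ`. -/
theorem sum_mul_conjTranspose_sum_le (a : X → Matrix Y Z ℂ) :
    (∑ i, a i) * (∑ i, a i)ᴴ ≤ (Fintype.card X : ℝ) • ∑ i, a i * (a i)ᴴ := by
  have h : (∑ i, ∑ j, (a i - a j) * (a i - a j)ᴴ).PosSemidef :=
    posSemidef_sum _ fun i _ => posSemidef_sum _ fun j _ => posSemidef_self_mul_conjTranspose _
  have h' := h.smul (show (0 : ℝ) ≤ 1 / 2 by norm_num)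
  rw [Matrix.le_iff]
  have e : (Fintype.card X : ℝ) • ∑ i, a i * (a i)ᴴ - (∑ i, a i) * (∑ i, a i)ᴴ =
      (1 / 2 : ℝ) • ∑ i, ∑ j, (a i - a j) * (a i - a j)ᴴ := by
    simp only [conjTranspose_sub, Matrix.mul_sub, Matrix.sub_mul, Finset.sum_sub_distrib,
      ← Matrix.mul_sum, ← Matrix.sum_mul, ← conjTranspose_sum, Finset.sum_const, Finset.card_univ,
      ← Finset.smul_sum]
    rw [← Nat.cast_smul_eq_nsmul ℝ]
    module
  rw [e]
  exact h'

/-- Cut a factor `G` of `M` into its block rows over `X`. Cauchy–Schwarz over the blocks costs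
`|X|`, and the resulting block-diagonal part of `M` is dominated by `1 ⊗ traceFst M`. -/
theorem le_card_smul_one_kronecker_traceFst {M : Matrix (X × Y) (X × Y) ℂ} (hM : M.PosSemidef) :
    M ≤ (Fintype.card X : ℝ) • ((1 : Matrix X X ℂ) ⊗ₖ traceFst M) := by
  obtain ⟨G, rfl⟩ := exists_mul_conjTranspose_eq hM
  -- `b x x'` is block row `x'` of `G` moved to position `x`: the diagonal terms rebuild `G`, all of
  -- them together give `1 ⊗ traceFst M`.
  let b : X → X → Matrix (X × Y) (X × Y) ℂ := fun x x' =>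
    Matrix.of fun p k => if p.1 = x then G (x', p.2) k else 0
  have h1 : G = ∑ x, b x x := by
    ext p k
    simp [Matrix.sum_apply, b]
  have h2 : (1 : Matrix X X ℂ) ⊗ₖ traceFst (G * Gᴴ) = ∑ x, ∑ x', b x x' * (b x x')ᴴ := by
    ext p p'
    simp only [kroneckerMap_apply, Matrix.one_apply, traceFst, of_apply, Matrix.sum_apply,
      Matrix.mul_apply, conjTranspose_apply, b]
    symm
    rw [Finset.sum_eq_single_of_mem p.1 (Finset.mem_univ _) fun x _ hx => by simp [Ne.symm hx]]
    by_cases h : p.1 = p'.1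
    · simp [h]
    · simp [h, Ne.symm h]
  have h3 : ∑ x, b x x * (b x x)ᴴ ≤ ∑ x, ∑ x', b x x' * (b x x')ᴴ :=
    Finset.sum_le_sum fun x _ => Finset.single_le_sum
      (f := fun x' => b x x' * (b x x')ᴴ) (fun x' _ => Matrix.nonneg_iff_posSemidef.2
      (posSemidef_self_mul_conjTranspose _)) (Finset.mem_univ x)
  conv_lhs => rw [h1]
  exact (sum_mul_conjTranspose_sum_le _).trans
    (smul_mono (h3.trans h2.ge) (Nat.cast_nonneg _))

theorem traceFst_tensorId {Φ : Matrix X X ℂ →ₗ[ℂ] Matrix Y Y ℂ} (hΦ : IsChannel Φ)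
    (M : Matrix (X × Z) (X × Z) ℂ) : traceFst (tensorId Z Φ M) = traceFst M := by
  ext z z'
  exact hΦ.2 (Matrix.of fun x x' => M (x, z) (x', z'))

theorem tensorId_kronecker (Φ : Matrix X X ℂ →ₗ[ℂ] Matrix Y Y ℂ) (M : Matrix X X ℂ)
    (N : Matrix Z Z ℂ) : tensorId Z Φ (M ⊗ₖ N) = Φ M ⊗ₖ N := by
  ext p p'
  have : (Matrix.of fun x x' => (M ⊗ₖ N) (x, p.2) (x', p'.2)) = N p.2 p'.2 • M := by
    ext x x'
    simp [mul_comm]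
  simp only [tensorId, LinearMap.coe_mk, AddHom.coe_mk, of_apply, this, map_smul]
  simp [mul_comm]

/-- The partial trace over the middle factor of `X ⊗ (W ⊗ Z)`. -/
def traceMid (M : Matrix (X × (W × Z)) (X × (W × Z)) ℂ) : Matrix (X × Z) (X × Z) ℂ :=
  Matrix.of fun p p' => ∑ w, M (p.1, (w, p.2)) (p'.1, (w, p'.2))

theorem tensorId_traceMid (Φ : Matrix X X ℂ →ₗ[ℂ] Matrix Y Y ℂ)
    (M : Matrix (X × (W × Z)) (X × (W × Z)) ℂ) :
    tensorId Z Φ (traceMid M) = traceMid (tensorId (W × Z) Φ M) := by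
  ext p p'
  have : (Matrix.of fun x x' => traceMid M (x, p.2) (x', p'.2)) =
      ∑ w, Matrix.of fun x x' => M (x, (w, p.2)) (x', (w, p'.2)) := by
    ext x x'
    simp [traceMid, Matrix.sum_apply]
  change Φ (Matrix.of fun x x' => traceMid M (x, p.2) (x', p'.2)) p.1 p'.1 = _
  rw [this, map_sum, Matrix.sum_apply]
  rfl

theorem traceMid_posSemidef {M : Matrix (X × (W × Z)) (X × (W × Z)) ℂ} (h : M.PosSemidef) :
    (traceMid M).PosSemidef := by
  have : traceMid M = ∑ w, M.submatrix (fun p : X × Z => (p.1, (w, p.2)))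
      (fun p : X × Z => (p.1, (w, p.2))) := by
    ext p p'
    simp [traceMid, Matrix.sum_apply]
  rw [this]
  exact posSemidef_sum _ fun w _ => h.submatrix _

theorem IsChannel.map_posSemidef {Φ : Matrix X X ℂ →ₗ[ℂ] Matrix Y Y ℂ} (hΦ : IsChannel Φ)
    {M : Matrix X X ℂ} (hM : M.PosSemidef) : (Φ M).PosSemidef :=
  (tensorId_posSemidef (Z := Unit) hΦ (hM.submatrix Prod.fst)).submatrix fun y => (y, ())

theorem IsChannel.map_mem_states {Φ : Matrix X X ℂ →ₗ[ℂ] Matrix Y Y ℂ} (hΦ : IsChannel Φ)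
    {M : Matrix X X ℂ} (hM : M ∈ states X) : Φ M ∈ states Y :=
  ⟨hΦ.map_posSemidef hM.1, (hΦ.2 M).trans hM.2⟩

theorem nonempty_of_mem_states {ρ : Matrix X X ℂ} (h : ρ ∈ states X) : Nonempty X := by
  by_contra hX
  rw [not_nonempty_iff] at hX
  have := h.2
  simp [Matrix.trace] at this

theorem traceSnd_mem_states {ρ : Matrix (X × Y) (X × Y) ℂ} (h : ρ ∈ states (X × Y)) :
    traceSnd ρ ∈ states X :=
  ⟨traceSnd_posSemidef h.1, (trace_traceSnd ρ).trans h.2⟩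

theorem traceSnd_mem_subStates {ρ : Matrix (X × Y) (X × Y) ℂ} (h : ρ ∈ subStates (X × Y)) :
    traceSnd ρ ∈ subStates X :=
  ⟨traceSnd_posSemidef h.1, by rw [trace_traceSnd]; exact h.2⟩

theorem submatrix_mem_subStates {ρ : Matrix X X ℂ} (h : ρ ∈ subStates X) (e : Y ≃ X) :
    ρ.submatrix e e ∈ subStates Y :=
  ⟨h.1.submatrix e, by rw [trace_submatrix_equiv]; exact h.2⟩

theorem inv_card_smul_one_mem_states [Nonempty X] :
    (Fintype.card X : ℝ)⁻¹ • (1 : Matrix X X ℂ) ∈ states X := by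
  refine ⟨PosSemidef.one.smul (by positivity), ?_⟩
  rw [trace_smul, trace_one, Complex.real_smul, Complex.ofReal_inv, Complex.ofReal_natCast,
    inv_mul_cancel₀]
  exact_mod_cast Fintype.card_ne_zero

end Blocks

/-! ### The effect of a protocol on `R B C` -/

namespace OneWayProtocol

variable {A B C R TA TB TA' TB' Q : Type*}
  [Fintype A] [DecidableEq A] [Fintype B] [DecidableEq B] [Fintype C] [DecidableEq C]
  [Fintype R] [DecidableEq R]
  [Fintype TA] [DecidableEq TA] [Fintype TB] [DecidableEq TB]
  [Fintype TA'] [DecidableEq TA'] [Fintype TB'] [DecidableEq TB']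
  [Fintype Q] [DecidableEq Q]

/-- The regrouping `(Q B T_B) ⊗ (A T_A' R) ≃ (A T_A' Q) ⊗ (B T_B R)`. -/
def receiveEquiv (A B TA' TB Q R : Type*) :
    ((Q × B × TB) × ((A × TA') × R)) ≃ ((A × TA' × Q) × ((B × TB) × R)) where
  toFun p := ((p.2.1.1, p.2.1.2, p.1.1), ((p.1.2.1, p.1.2.2), p.2.2))
  invFun p := ((p.1.2.2, p.2.1.1, p.2.1.2), ((p.1.1, p.1.2.1), p.2.2))
  left_inv _ := rfl
  right_inv _ := rfl

/-- The regrouping of the final systems, with Bob's systems first. -/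
def outputEquiv (U V R : Type*) : ((U × V) × R) ≃ (V × (U × R)) where
  toFun p := (p.1.2, (p.1.1, p.2))
  invFun p := ((p.2.1, p.1), p.2.2)
  left_inv _ := rfl
  right_inv _ := rfl

/-- The state, tensored with the reference system, after Alice's operation and the transmission. -/
def afterSend (P : OneWayProtocol A B C TA TB TA' TB' Q)
    (M : Matrix (((A × C × TA) × (B × TB)) × R) (((A × C × TA) × (B × TB)) × R) ℂ) :
    Matrix ((Q × B × TB) × ((A × TA') × R)) ((Q × B × TB) × ((A × TA') × R)) ℂ :=
  (tensorId ((B × TB) × R) P.enc (M.submatrix (Equiv.prodAssoc _ _ _).symm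
    (Equiv.prodAssoc _ _ _).symm)).submatrix (receiveEquiv A B TA' TB Q R)
      (receiveEquiv A B TA' TB Q R)

/-- Bystander systems, including `R`, are absorbed into the identity factor of each local operation,
so properties of the protocol reduce to those of `enc` and `dec`. -/
theorem tensorId_channel_apply (P : OneWayProtocol A B C TA TB TA' TB' Q)
    (M : Matrix (((A × C × TA) × (B × TB)) × R) (((A × C × TA) × (B × TB)) × R) ℂ) :
    tensorId R P.channel M =
      (tensorId ((A × TA') × R) P.dec (P.afterSend M)).submatrix (outputEquiv _ _ _)
        (outputEquiv _ _ _) := by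
  rfl

theorem channel_isChannel (P : OneWayProtocol A B C TA TB TA' TB' Q) : IsChannel P.channel := by
  refine ⟨fun k M hM => ?_, fun M => ?_⟩
  · rw [tensorId_channel_apply]
    exact (tensorId_posSemidef P.dec_isChannel ((tensorId_posSemidef P.enc_isChannel
      (hM.submatrix _)).submatrix _)).submatrix _
  · have h1 : P.channel M = (tensorId (A × TA') P.dec ((tensorId (B × TB) P.enc M).submatrix
        (sendEquiv A B TA' TB Q).symm (sendEquiv A B TA' TB Q).symm)).submatrix
        (Equiv.prodComm _ _) (Equiv.prodComm _ _) := rfl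
    rw [h1, trace_submatrix_equiv, trace_tensorId P.dec_isChannel, trace_submatrix_equiv,
      trace_tensorId P.enc_isChannel]

/-- The regrouping of the input systems as `(T_A T_B) ⊗ (A B C R)`. -/
def inputEquiv (A B C R TA TB : Type*) :
    (((A × C × TA) × (B × TB)) × R) ≃ ((TA × TB) × ((A × B × C) × R)) where
  toFun p := ((p.1.1.2.2, p.1.2.2), ((p.1.1.1, p.1.2.1, p.1.1.2.1), p.2))
  invFun p := (((p.2.1.1, p.2.1.2.2, p.1.1), (p.2.1.2.1, p.1.2)), p.2.2)
  left_inv _ := rfl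
  right_inv _ := rfl

/-- The regrouping of the final systems as `(T_A' T_B') ⊗ (A B C R)`. -/
def targetEquiv (A B C R TA' TB' : Type*) :
    (((A × TA') × (C × B × TB')) × R) ≃ ((TA' × TB') × ((A × B × C) × R)) where
  toFun p := ((p.1.1.2, p.1.2.2.2), ((p.1.1.1, p.1.2.2.1, p.1.2.1), p.2))
  invFun p := (((p.2.1.1, p.1.1), (p.2.1.2.2, p.2.1.2.1, p.1.2)), p.2.2)
  left_inv _ := rfl
  right_inv _ := rfl

theorem input_eq (Φ₁ : Matrix (TA × TB) (TA × TB) ℂ)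
    (τ : Matrix ((A × B × C) × R) ((A × B × C) × R) ℂ) :
    input Φ₁ τ = (Φ₁ ⊗ₖ τ).submatrix (inputEquiv A B C R TA TB) (inputEquiv A B C R TA TB) := rfl

theorem target_eq (Φ₂ : Matrix (TA' × TB') (TA' × TB') ℂ)
    (τ : Matrix ((A × B × C) × R) ((A × B × C) × R) ℂ) :
    target Φ₂ τ =
      (Φ₂ ⊗ₖ τ).submatrix (targetEquiv A B C R TA' TB') (targetEquiv A B C R TA' TB') := rfl

theorem input_mem_states {Φ₁ : Matrix (TA × TB) (TA × TB) ℂ}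
    {τ : Matrix ((A × B × C) × R) ((A × B × C) × R) ℂ} (h₁ : Φ₁ ∈ states _) (hτ : τ ∈ states _) :
    input Φ₁ τ ∈ states _ := by
  rw [input_eq]
  exact submatrix_mem_states (kronecker_mem_states h₁ hτ) _

theorem target_mem_states {Φ₂ : Matrix (TA' × TB') (TA' × TB') ℂ}
    {τ : Matrix ((A × B × C) × R) ((A × B × C) × R) ℂ} (h₂ : Φ₂ ∈ states _) (hτ : τ ∈ states _) :
    target Φ₂ τ ∈ states _ := by
  rw [target_eq]
  exact submatrix_mem_states (kronecker_mem_states h₂ hτ) _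

theorem tensorId_channel_mem_states (P : OneWayProtocol A B C TA TB TA' TB' Q)
    {M : Matrix (((A × C × TA) × (B × TB)) × R) (((A × C × TA) × (B × TB)) × R) ℂ}
    (hM : M ∈ states _) : tensorId R P.channel M ∈ states _ :=
  ⟨tensorId_posSemidef P.channel_isChannel hM.1, (trace_tensorId P.channel_isChannel M).trans hM.2⟩

/-- The regrouping of the final systems as `(R B C) ⊗ (A T_A' T_B')`. -/
def reduceEquiv (A B C R TA' TB' : Type*) :
    ((R × (B × C)) × ((A × TA') × TB')) ≃ (((A × TA') × (C × B × TB')) × R) where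
  toFun p := ((p.2.1, (p.1.2.2, p.1.2.1, p.2.2)), p.1.1)
  invFun p := ((p.2, (p.1.2.2.1, p.1.2.1)), (p.1.1, p.1.2.2.2))
  left_inv _ := rfl
  right_inv _ := rfl

/-- The reduced operator on `R B C` of an operator on the final systems. -/
def reduce (M : Matrix (((A × TA') × (C × B × TB')) × R) (((A × TA') × (C × B × TB')) × R) ℂ) :
    Matrix (R × (B × C)) (R × (B × C)) ℂ :=
  traceSnd (M.submatrix (reduceEquiv A B C R TA' TB') (reduceEquiv A B C R TA' TB'))

theorem reduce_target {Φ₂ : Matrix (TA' × TB') (TA' × TB') ℂ} (h₂ : Φ₂ ∈ states _)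
    (τ : Matrix ((A × B × C) × R) ((A × B × C) × R) ℂ) : reduce (target Φ₂ τ) = redRBC τ := by
  have h : ∑ x, ∑ y, Φ₂ (x, y) (x, y) = 1 := by
    have := h₂.2
    rwa [Matrix.trace, Fintype.sum_prod_type] at this
  ext p p'
  simp only [reduce, traceSnd, target, redRBC, of_apply, submatrix_apply, reduceEquiv,
    Equiv.coe_fn_mk, Fintype.sum_prod_type]
  simp only [← Finset.sum_mul, h, one_mul]

/-- The regrouping `(R B) ⊗ (A C) ≃ (A B C) ⊗ R`. -/
def redRBEquiv (A B C R : Type*) : ((R × B) × (A × C)) ≃ ((A × B × C) × R) where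
  toFun p := ((p.2.1, p.1.2, p.2.2), p.1.1)
  invFun p := ((p.2, p.1.2.1), (p.1.1, p.1.2.2))
  left_inv _ := rfl
  right_inv _ := rfl

theorem redRB_eq_traceSnd (τ : Matrix ((A × B × C) × R) ((A × B × C) × R) ℂ) :
    redRB τ = traceSnd (τ.submatrix (redRBEquiv A B C R) (redRBEquiv A B C R)) := by
  ext p p'
  simp [redRB, traceSnd, redRBEquiv, Fintype.sum_prod_type]

/-- The regrouping `(R B C) ⊗ A ≃ (A B C) ⊗ R`. -/
def redRBCEquiv (A B C R : Type*) : ((R × (B × C)) × A) ≃ ((A × B × C) × R) where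
  toFun p := ((p.2, p.1.2.1, p.1.2.2), p.1.1)
  invFun p := ((p.2, (p.1.2.1, p.1.2.2)), p.1.1)
  left_inv _ := rfl
  right_inv _ := rfl

theorem redRBC_eq_traceSnd (τ : Matrix ((A × B × C) × R) ((A × B × C) × R) ℂ) :
    redRBC τ = traceSnd (τ.submatrix (redRBCEquiv A B C R) (redRBCEquiv A B C R)) := rfl

theorem redRB_mem_states {τ : Matrix ((A × B × C) × R) ((A × B × C) × R) ℂ}
    (h : τ ∈ states _) : redRB τ ∈ states (R × B) := by
  rw [redRB_eq_traceSnd]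
  exact traceSnd_mem_states (submatrix_mem_states h _)

theorem redRBC_mem_states {τ : Matrix ((A × B × C) × R) ((A × B × C) × R) ℂ}
    (h : τ ∈ states _) : redRBC τ ∈ states (R × (B × C)) := by
  rw [redRBC_eq_traceSnd]
  exact traceSnd_mem_states (submatrix_mem_states h _)

/-- The systems `R B C` after the protocol, through Bob's operation alone. -/
theorem reduce_tensorId_channel (P : OneWayProtocol A B C TA TB TA' TB' Q)
    (M : Matrix (((A × C × TA) × (B × TB)) × R) (((A × C × TA) × (B × TB)) × R) ℂ) :
    reduce (tensorId R P.channel M) =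
      traceSnd ((tensorId R P.dec (traceMid (P.afterSend M))).submatrix
        (fun p : (R × (B × C)) × TB' => ((p.1.2.2, p.1.2.1, p.2), p.1.1))
        (fun p : (R × (B × C)) × TB' => ((p.1.2.2, p.1.2.1, p.2), p.1.1))) := by
  rw [tensorId_channel_apply, tensorId_traceMid]
  ext p p'
  simp only [reduce, traceSnd, of_apply, submatrix_apply, traceMid, outputEquiv, reduceEquiv,
    Equiv.coe_fn_mk]
  rw [Fintype.sum_prod_type_right]

/-- The state of `B T_B R` is not changed by Alice. -/
theorem traceFst_traceMid_afterSend (P : OneWayProtocol A B C TA TB TA' TB' Q)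
    (Φ₁ : Matrix (TA × TB) (TA × TB) ℂ) (τ : Matrix ((A × B × C) × R) ((A × B × C) × R) ℂ) :
    traceFst ((traceMid (P.afterSend (input Φ₁ τ))).submatrix
        (fun p : Q × ((B × TB) × R) => ((p.1, p.2.1.1, p.2.1.2), p.2.2))
        (fun p : Q × ((B × TB) × R) => ((p.1, p.2.1.1, p.2.1.2), p.2.2))) =
      (redRB τ ⊗ₖ traceFst Φ₁).submatrix
        (fun p : (B × TB) × R => ((p.2, p.1.1), p.1.2))
        (fun p : (B × TB) × R => ((p.2, p.1.1), p.1.2)) := by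
  have h := traceFst_tensorId P.enc_isChannel (Z := (B × TB) × R)
    ((input Φ₁ τ).submatrix (Equiv.prodAssoc _ _ _).symm (Equiv.prodAssoc _ _ _).symm)
  ext p p'
  have h' := congrFun (congrFun h p) p'
  simp only [traceFst, of_apply, Fintype.sum_prod_type] at h'
  simp only [traceFst, of_apply, submatrix_apply, traceMid, afterSend, receiveEquiv,
    Equiv.coe_fn_mk, kroneckerMap_apply, Fintype.sum_prod_type]
  rw [Finset.sum_comm]
  rw [Finset.sum_congr rfl fun a _ => Finset.sum_comm, h']
  simp only [input, of_apply, submatrix_apply, Equiv.prodAssoc_symm_apply, redRB, Finset.sum_mul,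
    Finset.mul_sum]
  symm
  rw [Finset.sum_comm]
  refine Finset.sum_congr rfl fun a _ => ?_
  rw [Finset.sum_comm]
  exact Finset.sum_congr rfl fun c _ => Finset.sum_congr rfl fun t _ => mul_comm _ _

theorem traceFst_mem_states {Φ₁ : Matrix (TA × TB) (TA × TB) ℂ} (h : Φ₁ ∈ states _) :
    traceFst Φ₁ ∈ states TB :=
  traceSnd_mem_states (submatrix_mem_states h (Equiv.prodComm TB TA))

theorem nonempty_message (P : OneWayProtocol A B C TA TB TA' TB' Q)
    [Nonempty (A × C × TA)] : Nonempty Q := by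
  obtain ⟨x⟩ := ‹Nonempty (A × C × TA)›
  obtain ⟨y⟩ := nonempty_of_mem_states (P.enc_isChannel.map_mem_states (single_mem_states x))
  exact ⟨y.2.2⟩

/-- If `ρ^{RB} ≤ c N ⊗ σ` before the protocol, then `ω^{RBC} ≤ |Q|² c N ⊗ σ'` after it. -/
theorem reduce_le (P : OneWayProtocol A B C TA TB TA' TB' Q) [Nonempty Q]
    {Φ₁ : Matrix (TA × TB) (TA × TB) ℂ} (h₁ : Φ₁ ∈ states _)
    {τ : Matrix ((A × B × C) × R) ((A × B × C) × R) ℂ} (hτ : τ.PosSemidef)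
    {N : Matrix R R ℂ} {σ : Matrix B B ℂ} (hσ : σ ∈ states B) {c : ℝ}
    (h : redRB τ ≤ c • (N ⊗ₖ σ)) :
    ∃ σ' ∈ states (B × C), reduce (tensorId R P.channel (input Φ₁ τ)) ≤
      ((Fintype.card Q : ℝ) ^ 2 * c) • (N ⊗ₖ σ') := by
  set D := traceMid (P.afterSend (input Φ₁ τ))
  have hin : (input Φ₁ τ).PosSemidef := by
    rw [input_eq]; exact (h₁.1.kronecker hτ).submatrix _
  have hD : D.PosSemidef := traceMid_posSemidef
    ((tensorId_posSemidef P.enc_isChannel (hin.submatrix _)).submatrix _)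
  have hφ := traceFst_mem_states h₁
  set φ := traceFst Φ₁
  set q : ℝ := (Fintype.card Q : ℝ) with hq_def
  have hq : 0 < q := by simp only [q]; exact_mod_cast Fintype.card_pos
  -- First factor `|Q|`: the dimension bound decouples the message from `B T_B R`.
  have step1 := le_card_smul_one_kronecker_traceFst
    (hD.submatrix (fun p : Q × ((B × TB) × R) => ((p.1, p.2.1.1, p.2.1.2), p.2.2)))
  rw [traceFst_traceMid_afterSend] at step1
  have step2 := submatrix_mono (kronecker_mono_left hφ.1 h)
    (fun p : (B × TB) × R => ((p.2, p.1.1), p.1.2))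
  have step3 := step1.trans (smul_mono (kronecker_mono_right PosSemidef.one step2) hq.le)
  have step4 := submatrix_mono step3
    (fun p : (Q × B × TB) × R => (p.1.1, ((p.1.2.1, p.1.2.2), p.2)))
  -- Second factor `|Q|`: `1_Q` is `|Q|` times the maximally mixed state, so that Bob's channel acts
  -- on a normalized product state.
  have hS0 : ((q⁻¹ • (1 : Matrix Q Q ℂ)) ⊗ₖ (σ ⊗ₖ φ)) ∈ states (Q × B × TB) :=
    kronecker_mem_states inv_card_smul_one_mem_states (kronecker_mem_states hσ hφ)
  set S0 := (q⁻¹ • (1 : Matrix Q Q ℂ)) ⊗ₖ (σ ⊗ₖ φ)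
  have step5 : D ≤ (q ^ 2 * c) • (S0 ⊗ₖ N) := by
    refine step4.trans_eq ?_
    ext p p'
    simp [S0, φ, -mul_eq_mul_left_iff]
    have : (q : ℂ) ≠ 0 := by exact_mod_cast hq.ne'
    field_simp
    simp [q]
    ring
  have step6 := tensorId_mono P.dec_isChannel step5
  have e7 : tensorId R P.dec ((q ^ 2 * c) • (S0 ⊗ₖ N)) = (q ^ 2 * c) • (P.dec S0 ⊗ₖ N) := by
    rw [← tensorId_kronecker]
    exact LinearMap.map_smul_of_tower _ _ _
  rw [e7] at step6
  have step8 := traceSnd_mono (submatrix_mono step6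
    (fun p : (R × (B × C)) × TB' => ((p.1.2.2, p.1.2.1, p.2), p.1.1)))
  rw [← reduce_tensorId_channel] at step8
  let e : ((B × C) × TB') ≃ (C × B × TB') :=
    { toFun := fun p => (p.1.2, p.1.1, p.2)
      invFun := fun p => ((p.2.1, p.1), p.2.2)
      left_inv := fun _ => rfl
      right_inv := fun _ => rfl }
  refine ⟨traceSnd ((P.dec S0).submatrix e e), traceSnd_mem_states (submatrix_mem_states
    (P.dec_isChannel.map_mem_states hS0) e), step8.trans_eq ?_⟩
  ext p p'
  simp only [traceSnd, of_apply, submatrix_apply, Matrix.smul_apply, kroneckerMap_apply, e,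
    Equiv.coe_fn_mk, Finset.mul_sum, Finset.smul_sum]
  exact Finset.sum_congr rfl fun t _ => by rw [mul_comm (N _ _)]

/-- Nobody acts on `R`. For the max-information this identifies the marginal in the bound after the
protocol with the one before. -/
theorem traceSnd_reduce (P : OneWayProtocol A B C TA TB TA' TB' Q)
    {Φ₁ : Matrix (TA × TB) (TA × TB) ℂ} (h₁ : Φ₁ ∈ states _)
    (τ : Matrix ((A × B × C) × R) ((A × B × C) × R) ℂ) :
    traceSnd (reduce (tensorId R P.channel (input Φ₁ τ))) = traceSnd (redRB τ) := by
  have h := traceFst_tensorId (Z := R) P.channel_isChannel (input Φ₁ τ)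
  have e1 : ∀ M : Matrix (((A × TA') × (C × B × TB')) × R) (((A × TA') × (C × B × TB')) × R) ℂ,
      traceSnd (reduce M) = traceFst M := by
    intro M
    ext r r'
    simp only [traceSnd, reduce, traceFst, of_apply, submatrix_apply, reduceEquiv,
      Equiv.coe_fn_mk]
    rw [← Fintype.sum_prod_type']
    let e : ((B × C) × ((A × TA') × TB')) ≃ ((A × TA') × (C × B × TB')) :=
      { toFun := fun p => (p.2.1, (p.1.2, p.1.1, p.2.2))
        invFun := fun p => ((p.2.2.1, p.2.1), (p.1, p.2.2.2))
        left_inv := fun _ => rfl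
        right_inv := fun _ => rfl }
    exact Equiv.sum_comp e fun x => M (x, r) (x, r')
  rw [e1, h]
  have h' : ∑ x, Φ₁ x x = 1 := h₁.2
  ext r r'
  simp only [traceFst, of_apply, traceSnd, redRB]
  let e : ((TA × TB) × (B × A × C)) ≃ ((A × C × TA) × (B × TB)) :=
    { toFun := fun p => ((p.2.2.1, p.2.2.2, p.1.1), (p.2.1, p.1.2))
      invFun := fun p => ((p.1.2.2, p.2.2), (p.2.1, p.1.1, p.1.2.1))
      left_inv := fun _ => rfl
      right_inv := fun _ => rfl }
  rw [← Equiv.sum_comp e, Fintype.sum_prod_type]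
  simp only [input, of_apply, e, Equiv.coe_fn_mk, ← Finset.mul_sum, ← Finset.sum_mul, h', one_mul]
  simp only [Fintype.sum_prod_type]

/-- A protocol turns states near `ρ^{RB}` into states near `ρ^{RBC}`. -/
theorem IsStateRedistribution.exists_near {P : OneWayProtocol A B C TA TB TA' TB' Q}
    {τ : Matrix ((A × B × C) × R) ((A × B × C) × R) ℂ} (hτ : τ ∈ states _) {ε₁ ε₂ : ℝ}
    (hP : P.IsStateRedistribution τ ε₁) (h₁ : 0 ≤ ε₁) (h₂ : 0 ≤ ε₂) (h : ε₁ + ε₂ ≤ 1)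
    {ρ' : Matrix (R × B) (R × B) ℂ} (hρ' : ρ' ∈ smoothBall ε₂ (redRB τ)) :
    ∃ ω ∈ smoothBall (ε₁ + ε₂) (redRBC τ), traceSnd ω = traceSnd ρ' ∧
      ∀ (N : Matrix R R ℂ) (c : ℝ), ∀ σ ∈ states B, ρ' ≤ c • (N ⊗ₖ σ) →
        ∃ σ' ∈ states (B × C), ω ≤ ((Fintype.card Q : ℝ) ^ 2 * c) • (N ⊗ₖ σ') := by
  obtain ⟨Φ₁, hΦ₁, Φ₂, hΦ₂, hd⟩ := hP
  obtain ⟨⟨⟨a, b, c⟩, r⟩⟩ := nonempty_of_mem_states hτ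
  obtain ⟨⟨ta, tb⟩⟩ := nonempty_of_mem_states hΦ₁
  have : Nonempty (A × C) := ⟨(a, c)⟩
  have : Nonempty (A × C × TA) := ⟨(a, c, ta)⟩
  have : Nonempty Q := P.nonempty_message
  have hτ₁ := submatrix_mem_states hτ (redRBEquiv A B C R)
  -- `ρ'` is lifted to a nearby operator on all of `A B C R`, on which the protocol can be run.
  obtain ⟨T, hT, hTr, hTf⟩ := exists_extension_fidelity_le hτ₁.1 hρ'.1.1
  rw [← redRB_eq_traceSnd] at hTf
  set τ' := T.submatrix (redRBEquiv A B C R).symm (redRBEquiv A B C R).symm with hτ'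
  have hTτ : τ'.submatrix (redRBEquiv A B C R) (redRBEquiv A B C R) = T := by
    simp [hτ']
  have hτ'p : τ'.PosSemidef := hT.submatrix _
  have hred : redRB τ' = ρ' := by rw [redRB_eq_traceSnd, hTτ, hTr]
  have hτ's : τ' ∈ subStates ((A × B × C) × R) := by
    refine ⟨hτ'p, ?_⟩
    rw [hτ', trace_submatrix_equiv, ← trace_traceSnd, hTr]
    exact hρ'.1.2
  have hin' : input Φ₁ τ' ∈ subStates _ := by
    rw [input_eq]
    exact submatrix_mem_subStates (kronecker_mem_subStates hΦ₁ hτ's) _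
  have hin := input_mem_states hΦ₁ hτ
  have hout := P.tensorId_channel_mem_states hin
  have hout' := tensorId_mem_subStates P.channel_isChannel hin'
  have htar := target_mem_states hΦ₂ hτ
  have f1 : fidelity (redRB τ) ρ' ≤
      fidelity (tensorId R P.channel (input Φ₁ τ)) (tensorId R P.channel (input Φ₁ τ')) := by
    refine hTf.trans ?_
    have := fidelity_le_submatrix hτ₁.1 hT (redRBEquiv A B C R).symm
    rw [← hτ'] at this
    refine this.trans ?_
    simp only [submatrix_submatrix, Equiv.self_comp_symm, submatrix_id_id]
    refine (fidelity_le_kronecker hΦ₁ hτ.1 hτ'p).trans ?_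
    refine (fidelity_le_submatrix (hΦ₁.1.kronecker hτ.1) (hΦ₁.1.kronecker hτ'p)
      (inputEquiv A B C R TA TB)).trans ?_
    exact fidelity_le_tensorId P.channel_isChannel hin.1 hin'.1
  have g1 := (purifiedDist_le_iff (redRB_mem_states hτ) h₂).1 hρ'.2
  have g2 := (purifiedDist_le_iff hout h₁).1 hd
  have g3 : 1 - ε₂ ^ 2 ≤ fidelity (tensorId R P.channel (input Φ₁ τ))
      (tensorId R P.channel (input Φ₁ τ')) ^ 2 :=
    g1.trans (pow_le_pow_left₀ (fidelity_nonneg _ _) f1 2)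
  rw [fidelity_comm hout.1 htar.1] at g2
  -- The triangle passes through the actual output on `τ`, which is normalized; the perturbed output
  -- need not be.
  have g4 := one_sub_sq_le_fidelity_sq_triangle (states_subset_subStates htar) hout hout'
    h₁ h₂ h g2 g3
  have f2 : fidelity (target Φ₂ τ) (tensorId R P.channel (input Φ₁ τ')) ≤
      fidelity (redRBC τ) (reduce (tensorId R P.channel (input Φ₁ τ'))) := by
    rw [← reduce_target hΦ₂]
    exact (fidelity_le_submatrix htar.1 hout'.1 (reduceEquiv A B C R TA' TB')).trans
      (fidelity_le_traceSnd (htar.1.submatrix _) (hout'.1.submatrix _))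
  refine ⟨reduce (tensorId R P.channel (input Φ₁ τ')), ⟨traceSnd_mem_subStates
    (submatrix_mem_subStates hout' _), ?_⟩, ?_, fun N c σ hσ hle => ?_⟩
  · rw [purifiedDist_le_iff (redRBC_mem_states hτ) (add_nonneg h₁ h₂)]
    exact g4.trans (pow_le_pow_left₀ (fidelity_nonneg _ _) f2 2)
  · rw [traceSnd_reduce P hΦ₁, hred]
  · exact P.reduce_le hΦ₁ hτ'p hσ (hred ▸ hle)

end OneWayProtocol

/-! ### Finiteness of the smooth quantities -/

section Finiteness

variable {A B : Type*} [Fintype A] [DecidableEq A] [Fintype B] [DecidableEq B]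

theorem Imax_le {ρ : Matrix (A × B) (A × B) ℂ} {σ : Matrix B B ℂ} (hσ : σ ∈ states B) {l : ℝ}
    (h : ρ ≤ (2 : ℝ) ^ l • (traceSnd ρ ⊗ₖ σ)) : Imax ρ ≤ l :=
  iInf₂_le_of_le σ hσ (iInf₂_le l h)

theorem le_Imax {ρ : Matrix (A × B) (A × B) ℂ} {x : EReal}
    (h : ∀ σ ∈ states B, ∀ l : ℝ, ρ ≤ (2 : ℝ) ^ l • (traceSnd ρ ⊗ₖ σ) → x ≤ l) : x ≤ Imax ρ :=
  le_iInf₂ fun σ hσ => le_iInf₂ fun l hl => h σ hσ l hl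

theorem neg_le_Hmin {ρ : Matrix (A × B) (A × B) ℂ} {σ : Matrix B B ℂ} (hσ : σ ∈ states B) {l : ℝ}
    (h : ρ ≤ (2 : ℝ) ^ l • ((1 : Matrix A A ℂ) ⊗ₖ σ)) : -(l : EReal) ≤ Hmin ρ :=
  EReal.neg_le_neg_iff.2 (iInf₂_le_of_le σ hσ (iInf₂_le l h))

theorem Hmin_le {ρ : Matrix (A × B) (A × B) ℂ} {x : EReal}
    (h : ∀ σ ∈ states B, ∀ l : ℝ, ρ ≤ (2 : ℝ) ^ l • ((1 : Matrix A A ℂ) ⊗ₖ σ) → -(l : EReal) ≤ x) :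
    Hmin ρ ≤ x :=
  EReal.neg_le_of_neg_le (le_iInf₂ fun σ hσ => le_iInf₂ fun l hl =>
    EReal.neg_le_of_neg_le (h σ hσ l hl))

theorem Hmin_anti {ρ ρ' : Matrix (A × B) (A × B) ℂ} (h : ρ ≤ ρ') : Hmin ρ' ≤ Hmin ρ :=
  Hmin_le fun _ hσ _ hl => neg_le_Hmin hσ (h.trans hl)

theorem trace_re_smul (c : ℝ) (M : Matrix A A ℂ) : (c • M).trace.re = c * M.trace.re := by
  simp [trace_smul]

theorem le_card_smul_one {ρ : Matrix A A ℂ} (hρ : ρ ∈ states A) :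
    ρ ≤ (Fintype.card A : ℝ) • (1 : Matrix A A ℂ) := by
  have h := submatrix_mono (le_card_smul_one_kronecker_traceFst
    (hρ.1.submatrix (Prod.fst : A × Unit → A))) fun a : A => (a, ())
  refine h.trans_eq ?_
  have h' : ∑ x, ρ x x = 1 := hρ.2
  ext a a'
  simp [traceFst, h', Matrix.one_apply]

theorem le_card_smul_traceSnd_kronecker_one {ρ : Matrix (A × B) (A × B) ℂ} (hρ : ρ.PosSemidef) :
    ρ ≤ (Fintype.card B : ℝ) • (traceSnd ρ ⊗ₖ (1 : Matrix B B ℂ)) := by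
  have h := submatrix_mono (le_card_smul_one_kronecker_traceFst
    (hρ.submatrix (Prod.swap : B × A → A × B))) (Prod.swap : A × B → B × A)
  refine h.trans_eq ?_
  ext p p'
  simp [traceFst, traceSnd, mul_comm]
  exact Or.inl (Or.inl rfl)

theorem two_rpow_logb {c : ℝ} (hc : 0 < c) : (2 : ℝ) ^ Real.logb 2 c = c :=
  Real.rpow_logb two_pos (by norm_num) hc

theorem mem_smoothBall_self {ρ : Matrix A A ℂ} (hρ : ρ ∈ states A) {ε : ℝ} (hε : 0 ≤ ε) :
    ρ ∈ smoothBall ε ρ := by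
  refine ⟨states_subset_subStates hρ, (purifiedDist_le_iff hρ hε).2 ?_⟩
  have := fidelity_self hρ.1
  rw [hρ.2, Complex.one_re] at this
  nlinarith

theorem le_trace_of_mem_smoothBall {ρ ρ' : Matrix A A ℂ} (hρ : ρ ∈ states A) {ε : ℝ} (hε : 0 ≤ ε)
    (h : ρ' ∈ smoothBall ε ρ) : 1 - ε ^ 2 ≤ ρ'.trace.re := by
  refine ((purifiedDist_le_iff hρ hε).1 h.2).trans ?_
  rw [fidelity_comm hρ.1 h.1.1]
  exact fidelity_sq_le_trace h.1.1 hρ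

theorem exists_real_eq {x : EReal} {a b : ℝ} (ha : (a : EReal) ≤ x) (hb : x ≤ b) :
    ∃ r : ℝ, x = r :=
  ⟨x.toReal, (EReal.coe_toReal (ne_top_of_le_ne_top (EReal.coe_ne_top b) hb)
    (ne_bot_of_le_ne_bot (EReal.coe_ne_bot a) ha)).symm⟩

/-- Below: taking traces in the defining inequality gives `2^l ≥ 1`, as traces in the ball are
positive for `ε < 1`. Above: the unsmoothed state with `σ` maximally mixed. -/
theorem exists_real_eq_smoothImax {ρ : Matrix (A × B) (A × B) ℂ} (hρ : ρ ∈ states (A × B))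
    {ε : ℝ} (h₀ : 0 ≤ ε) (h₁ : ε < 1) : ∃ x : ℝ, smoothImax ε ρ = x := by
  obtain ⟨⟨a, b⟩⟩ := nonempty_of_mem_states hρ
  have : Nonempty B := ⟨b⟩
  refine exists_real_eq (a := 0) (b := Real.logb 2 ((Fintype.card B : ℝ) * Fintype.card B))
    (le_iInf₂ fun ρ' hρ' => le_Imax fun σ hσ l hl => ?_)
    (iInf₂_le_of_le ρ (mem_smoothBall_self hρ h₀) (Imax_le inv_card_smul_one_mem_states ?_))
  · have h1 := le_trace_of_mem_smoothBall hρ h₀ hρ'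
    have h2 := trace_re_mono hl
    rw [trace_re_smul, trace_kronecker, hσ.2, mul_one, trace_traceSnd] at h2
    have h3 : 0 < ρ'.trace.re := by nlinarith
    have h4 : (1 : ℝ) ≤ 2 ^ l := by
      by_contra hlt
      nlinarith
    have h5 : 0 ≤ l := by
      by_contra hlt
      exact absurd h4 (not_le.2 (Real.rpow_lt_one_of_one_lt_of_neg one_lt_two (not_le.1 hlt)))
    exact_mod_cast h5
  · have hB : (0 : ℝ) < Fintype.card B := by exact_mod_cast Fintype.card_pos
    rw [two_rpow_logb (mul_pos hB hB), kronecker_smul, smul_smul, mul_assoc,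
      mul_inv_cancel₀ hB.ne', mul_one]
    exact le_card_smul_traceSnd_kronecker_one hρ.1

/-- Below: the unsmoothed state with `σ` maximally mixed. Above: taking traces gives `1 - ε² ≤ 2^l
|A|`. -/
theorem exists_real_eq_smoothHmin {ρ : Matrix (A × B) (A × B) ℂ} (hρ : ρ ∈ states (A × B))
    {ε : ℝ} (h₀ : 0 ≤ ε) (h₁ : ε < 1) : ∃ x : ℝ, smoothHmin ε ρ = x := by
  obtain ⟨⟨a, b⟩⟩ := nonempty_of_mem_states hρ
  have : Nonempty B := ⟨b⟩
  have : Nonempty A := ⟨a⟩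
  have hA : (0 : ℝ) < Fintype.card A := by exact_mod_cast Fintype.card_pos
  have hB : (0 : ℝ) < Fintype.card B := by exact_mod_cast Fintype.card_pos
  have hε : 0 < 1 - ε ^ 2 := by nlinarith
  refine exists_real_eq
    (a := -Real.logb 2 ((Fintype.card (A × B) : ℝ) * Fintype.card B))
    (b := -Real.logb 2 ((1 - ε ^ 2) / Fintype.card A))
    (le_iSup₂_of_le ρ (mem_smoothBall_self hρ h₀) ?_)
    (iSup₂_le fun ρ' hρ' => Hmin_le fun σ hσ l hl => ?_)
  · rw [EReal.coe_neg]
    refine neg_le_Hmin inv_card_smul_one_mem_states ?_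
    rw [two_rpow_logb (mul_pos (by exact_mod_cast Fintype.card_pos) hB), kronecker_smul, smul_smul,
      mul_assoc, mul_inv_cancel₀ hB.ne', mul_one, one_kronecker_one]
    exact le_card_smul_one hρ
  · rw [← EReal.coe_neg, EReal.coe_le_coe_iff, neg_le_neg_iff,
      Real.logb_le_iff_le_rpow one_lt_two (by positivity), div_le_iff₀ hA]
    refine (le_trace_of_mem_smoothBall hρ h₀ hρ').trans ((trace_re_mono hl).trans_eq ?_)
    rw [trace_re_smul, trace_kronecker, hσ.2, mul_one, trace_one, Complex.natCast_re]

end Finiteness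

/-! ### Duality of smooth min- and max-entropies -/

section Duality

variable {X Y Z W : Type*} [Fintype X] [DecidableEq X] [Fintype Y] [DecidableEq Y]
  [Fintype Z] [DecidableEq Z] [Fintype W] [DecidableEq W]

/-- A factor of an operator on `X ⊗ Y`, seen as a factor of the complementary operator
on `X ⊗ Z`. -/
def flip (M : Matrix (X × Y) Z ℂ) : Matrix (X × Z) Y ℂ := Matrix.of fun p y => M (p.1, y) p.2

theorem trace_flip_mul (M N : Matrix (X × Y) Z ℂ) :
    (flip M * (flip N)ᴴ).trace = (M * Nᴴ).trace := by
  simp only [Matrix.trace, Matrix.diag_apply, Matrix.mul_apply, Fintype.sum_prod_type, flip,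
    of_apply, conjTranspose_apply]
  exact Finset.sum_congr rfl fun x _ => Finset.sum_comm

theorem flip_mul (M : Matrix (X × Y) Z ℂ) (L : Matrix Z W ℂ) :
    flip (M * L) = ((1 : Matrix X X ℂ) ⊗ₖ Lᵀ) * flip M := by
  ext p y
  simp only [flip, of_apply, Matrix.mul_apply, kroneckerMap_apply, transpose_apply,
    Fintype.sum_prod_type]
  rw [Finset.sum_eq_single_of_mem p.1 (Finset.mem_univ _) fun x _ hx => by simp [Ne.symm hx]]
  simp [mul_comm]

theorem exists_state_ge [Nonempty X] {ρ : Matrix X X ℂ} (hρ : ρ ∈ subStates X) :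
    ∃ σ ∈ states X, ρ ≤ σ := by
  have hs := single_mem_states (Classical.arbitrary X)
  set s := Matrix.single (Classical.arbitrary X) (Classical.arbitrary X) (1 : ℂ)
  have h := hs.1.smul (sub_nonneg.2 hρ.2)
  refine ⟨ρ + (1 - ρ.trace.re) • s, ⟨hρ.1.add h, ?_⟩, ?_⟩
  · rw [trace_add, trace_smul, hs.2, posSemidef_trace_eq_re hρ.1]
    simp
  · rw [Matrix.le_iff, add_sub_cancel_left]
    exact h

/-- Local contractions on the conditioning system do not decrease the min-entropy. -/
theorem Hmin_flip_le_Hmin_flip_mul [Nonempty W] (M : Matrix (X × Y) Z ℂ) {L : Matrix Z W ℂ}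
    (hL : L * Lᴴ ≤ 1) :
    Hmin (flip M * (flip M)ᴴ) ≤ Hmin (flip (M * L) * (flip (M * L))ᴴ) := by
  refine Hmin_le fun σ hσ l hl => ?_
  -- The contraction `L` acts on the conditioning system as `Lᵀ`; it maps `σ` to a sub-normalized
  -- state, which is then enlarged to a state.
  have hσ' : Lᵀ * σ * (Lᵀ)ᴴ ∈ subStates W := by
    refine ⟨hσ.1.mul_mul_conjTranspose_same _, ?_⟩
    have h0 := posSemidef_transpose_iff.2 (Matrix.le_iff.1 hL)
    rw [transpose_sub, transpose_one, transpose_mul] at h0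
    have h1 := trace_re_mono (mul_mul_conjTranspose_mono (Matrix.le_iff.2 h0) (CFC.sqrt σ))
    have e : (Lᵀ * σ * (Lᵀ)ᴴ).trace =
        (CFC.sqrt σ * ((Lᴴ)ᵀ * Lᵀ) * (CFC.sqrt σ)ᴴ).trace := by
      rw [sqrt_conjTranspose, trace_mul_comm (CFC.sqrt σ * _), ← Matrix.mul_assoc,
        sqrt_mul_sqrt hσ.1, trace_mul_comm, ← Matrix.mul_assoc, trace_mul_comm]
      rfl
    rw [e]
    refine h1.trans_eq ?_
    rw [Matrix.mul_one, sqrt_conjTranspose, sqrt_mul_sqrt hσ.1, hσ.2, Complex.one_re]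
  obtain ⟨σ', hσ's, hle⟩ := exists_state_ge hσ'
  refine neg_le_Hmin hσ's ?_
  have h1 := mul_mul_conjTranspose_mono hl ((1 : Matrix X X ℂ) ⊗ₖ Lᵀ)
  have e1 : flip (M * L) * (flip (M * L))ᴴ =
      ((1 : Matrix X X ℂ) ⊗ₖ Lᵀ) * (flip M * (flip M)ᴴ) * ((1 : Matrix X X ℂ) ⊗ₖ Lᵀ)ᴴ := by
    rw [flip_mul, conjTranspose_mul]
    simp only [Matrix.mul_assoc]
  rw [e1]
  refine h1.trans ?_
  rw [Matrix.mul_smul, Matrix.smul_mul, conjTranspose_kronecker, ← mul_kronecker_mul,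
    ← mul_kronecker_mul]
  simp only [conjTranspose_one, Matrix.mul_one]
  exact smul_mono (kronecker_mono_right PosSemidef.one hle) (by positivity)

theorem Hmax_eq_neg_Hmin_flip (ρ : Matrix (X × Y) (X × Y) ℂ) :
    Hmax ρ = -Hmin (flip (CFC.sqrt ρ) * (flip (CFC.sqrt ρ))ᴴ) := by
  have : dropMiddle (ketbra (canonicalPurification ρ)) =
      flip (CFC.sqrt ρ) * (flip (CFC.sqrt ρ))ᴴ := by
    ext p p'
    simp [dropMiddle, ketbra, canonicalPurification, Matrix.vecMulVec_apply, flip,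
      Matrix.mul_apply]
  rw [Hmax, this]

/-- Flipping preserves overlaps of factors, so a factor that attains the fidelity on `X ⊗ Z`
certifies at least that fidelity on `X ⊗ Y`. -/
theorem mul_conjTranspose_flip_mem_smoothBall {M N : Matrix (X × Y) Z ℂ} {ε : ℝ} (hε : 0 ≤ ε)
    (hM : M * Mᴴ ∈ states (X × Y)) {ρ : Matrix (X × Z) (X × Z) ℂ}
    (hρ : ρ ∈ smoothBall ε (flip M * (flip M)ᴴ)) (hN : flip N * (flip N)ᴴ ≤ ρ)
    (h : (flip N * (flip M)ᴴ).trace = (fidelity ρ (flip M * (flip M)ᴴ) : ℂ)) :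
    N * Nᴴ ∈ smoothBall ε (M * Mᴴ) := by
  have hM' : flip M * (flip M)ᴴ ∈ states (X × Z) :=
    ⟨posSemidef_self_mul_conjTranspose _, (trace_flip_mul M M).trans hM.2⟩
  refine ⟨⟨posSemidef_self_mul_conjTranspose _, ?_⟩, ?_⟩
  · rw [← trace_flip_mul]
    exact (trace_re_mono hN).trans hρ.1.2
  · rw [purifiedDist_le_iff hM hε]
    refine ((purifiedDist_le_iff hM' hε).1 hρ.2).trans
      (pow_le_pow_left₀ (fidelity_nonneg _ _) ?_ 2)
    rw [fidelity_comm hM'.1 hρ.1.1,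
      fidelity_comm hM.1 (posSemidef_self_mul_conjTranspose _)]
    have key := re_trace_mul_conjTranspose_le_fidelity (posSemidef_self_mul_conjTranspose N)
      hM.1 le_rfl le_rfl
    rwa [← trace_flip_mul, h, Complex.ofReal_re] at key

/-- Duality of the smooth min- and max-entropies of a pure state on `X ⊗ Y ⊗ Z`. -/
theorem smoothHmax_eq_neg_smoothHmin_flip {M : Matrix (X × Y) Z ℂ}
    (hM : M * Mᴴ ∈ states (X × Y)) {ε : ℝ} (hε : 0 ≤ ε) :
    smoothHmax ε (M * Mᴴ) = -smoothHmin ε (flip M * (flip M)ᴴ) := by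
  have hM' : flip M * (flip M)ᴴ ∈ states (X × Z) :=
    ⟨posSemidef_self_mul_conjTranspose _, (trace_flip_mul M M).trans hM.2⟩
  obtain ⟨⟨x, y⟩⟩ := nonempty_of_mem_states hM
  obtain ⟨⟨-, z⟩⟩ := nonempty_of_mem_states hM'
  have : Nonempty Z := ⟨z⟩
  have : Nonempty (X × Y) := ⟨(x, y)⟩
  apply le_antisymm
  · rw [EReal.le_neg]
    refine iSup₂_le fun ρ' hρ' => ?_
    rw [EReal.le_neg]
    -- A state near the `X Z` marginal yields one near the `X Y` marginal through its Uhlmann factor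
    -- `a`; `flip` is its own inverse.
    obtain ⟨a, ha, h⟩ := exists_trace_eq_fidelity hρ'.1.1 hM'.1 (b := flip M) rfl
    have hN := mul_conjTranspose_flip_mem_smoothBall (N := flip a) hε hM hρ' ha h
    refine iInf₂_le_of_le _ hN ?_
    rw [Hmax_eq_neg_Hmin_flip, EReal.neg_le_neg_iff]
    -- `Hmax` uses the canonical purification, which is `flip a` times the contraction `Vᴴ` on the
    -- purifying system; this only increases the min-entropy.
    obtain ⟨V, hV, -, hNV⟩ := exists_contraction_of_le_posSemidef
      (posSemidef_self_mul_conjTranspose (flip a)) (a := flip a) le_rfl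
    rw [← hNV rfl]
    refine (Hmin_anti ha).trans (Hmin_flip_le_Hmin_flip_mul (flip a) (L := Vᴴ) ?_)
    simpa using conjTranspose_mul_self_le_one hV
  · refine le_iInf₂ fun ρ' hρ' => ?_
    rw [Hmax_eq_neg_Hmin_flip, EReal.neg_le_neg_iff]
    -- Conversely, a contraction on the canonical purification of `ρ'` aligns it with `M`, without
    -- decreasing the min-entropy.
    obtain ⟨K, hK, h⟩ := exists_contraction_trace_eq_fidelity ρ' hM.1 (b := M) rfl
    have hN := mul_conjTranspose_flip_mem_smoothBall (M := flip M) (N := flip (CFC.sqrt ρ' * K))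
      hε hM' hρ' (mul_contraction_le hρ'.1.1 hK) h
    exact (Hmin_flip_le_Hmin_flip_mul _ hK).trans (le_iSup₂_of_le _ hN le_rfl)

variable {A B C R : Type*} [Fintype A] [DecidableEq A] [Fintype B] [DecidableEq B]
  [Fintype C] [DecidableEq C] [Fintype R] [DecidableEq R]

open OneWayProtocol

/-- In the pure state of `A B C R`, the complement of `R B` is `A C`: reading `ψ` as a matrix from
`A C` to `R B` gives both marginals. -/
theorem smoothHmax_redRB {τ : Matrix ((A × B × C) × R) ((A × B × C) × R) ℂ}
    (hτ : τ ∈ states _) {ψ : (A × B × C) × R → ℂ} (hψ : τ = ketbra ψ) {ε : ℝ} (hε : 0 ≤ ε) :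
    smoothHmax ε (redRB τ) = -smoothHmin ε (redRAC τ) := by
  let M : Matrix (R × B) (A × C) ℂ := Matrix.of fun p q => ψ ((q.1, p.2, q.2), p.1)
  have h1 : redRB τ = M * Mᴴ := by
    ext p p'
    simp [redRB, hψ, M, ketbra, Matrix.vecMulVec_apply, Matrix.mul_apply, Fintype.sum_prod_type]
  have h2 : redRAC τ = flip M * (flip M)ᴴ := by
    ext p p'
    simp [redRAC, hψ, M, ketbra, Matrix.vecMulVec_apply, Matrix.mul_apply, flip]
  have h := redRB_mem_states hτ
  rw [h1] at h
  rw [h1, h2, smoothHmax_eq_neg_smoothHmin_flip h hε]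

theorem smoothHmax_redRBC {τ : Matrix ((A × B × C) × R) ((A × B × C) × R) ℂ}
    (hτ : τ ∈ states _) {ψ : (A × B × C) × R → ℂ} (hψ : τ = ketbra ψ) {ε : ℝ} (hε : 0 ≤ ε) :
    smoothHmax ε (redRBC τ) = -smoothHmin ε (redRA τ) := by
  let M : Matrix (R × (B × C)) A ℂ := Matrix.of fun p q => ψ ((q, p.2.1, p.2.2), p.1)
  have h1 : redRBC τ = M * Mᴴ := by
    ext p p'
    simp [redRBC, hψ, M, ketbra, Matrix.vecMulVec_apply, Matrix.mul_apply]
  have h2 : redRA τ = flip M * (flip M)ᴴ := by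
    ext p p'
    simp [redRA, hψ, M, ketbra, Matrix.vecMulVec_apply, Matrix.mul_apply, flip,
      Fintype.sum_prod_type]
  have h := redRBC_mem_states hτ
  rw [h1] at h
  rw [h1, h2, smoothHmax_eq_neg_smoothHmin_flip h hε]

end Duality

/-! ### The bounds for `I_max` and `H_min` on Bob's side -/

namespace OneWayProtocol

variable {A B C R TA TB TA' TB' Q : Type*}
  [Fintype A] [DecidableEq A] [Fintype B] [DecidableEq B] [Fintype C] [DecidableEq C]
  [Fintype R] [DecidableEq R]
  [Fintype TA] [DecidableEq TA] [Fintype TB] [DecidableEq TB]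
  [Fintype TA'] [DecidableEq TA'] [Fintype TB'] [DecidableEq TB']
  [Fintype Q] [DecidableEq Q]

theorem two_rpow_add_two_mul_cost (P : OneWayProtocol A B C TA TB TA' TB' Q) [Nonempty Q] (l : ℝ) :
    (2 : ℝ) ^ (l + 2 * P.cost) = (Fintype.card Q : ℝ) ^ 2 * 2 ^ l := by
  have hQ : (0 : ℝ) < Fintype.card Q := by exact_mod_cast Fintype.card_pos
  rw [Real.rpow_add two_pos, mul_comm 2 P.cost, Real.rpow_mul two_pos.le, cost, two_rpow_logb hQ,
    mul_comm, Real.rpow_two]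

theorem IsStateRedistribution.nonempty_message {P : OneWayProtocol A B C TA TB TA' TB' Q}
    {τ : Matrix ((A × B × C) × R) ((A × B × C) × R) ℂ} (hτ : τ ∈ states _) {ε : ℝ}
    (hP : P.IsStateRedistribution τ ε) : Nonempty Q := by
  obtain ⟨Φ₁, hΦ₁, -⟩ := hP
  obtain ⟨⟨⟨a, b, c⟩, r⟩⟩ := nonempty_of_mem_states hτ
  obtain ⟨⟨ta, tb⟩⟩ := nonempty_of_mem_states hΦ₁
  have : Nonempty (A × C × TA) := ⟨(a, c, ta)⟩
  exact P.nonempty_message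

theorem IsStateRedistribution.geHalfDiff_smoothImax {P : OneWayProtocol A B C TA TB TA' TB' Q}
    {τ : Matrix ((A × B × C) × R) ((A × B × C) × R) ℂ} (hτ : τ ∈ states _) {ε₁ ε₂ : ℝ}
    (hP : P.IsStateRedistribution τ ε₁) (h₁ : 0 ≤ ε₁) (h₂ : 0 ≤ ε₂) (h : ε₁ + ε₂ < 1) :
    GeHalfDiff P.cost (smoothImax (ε₁ + ε₂) (redRBC τ)) (smoothImax ε₂ (redRB τ)) := by
  have := hP.nonempty_message hτ
  obtain ⟨x, hx⟩ := exists_real_eq_smoothImax (redRBC_mem_states hτ) (add_nonneg h₁ h₂) h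
  obtain ⟨y, hy⟩ := exists_real_eq_smoothImax (redRB_mem_states hτ) h₂ (by linarith : ε₂ < 1)
  refine ⟨x, y, hx, hy, ?_⟩
  have key : ((x - 2 * P.cost : ℝ) : EReal) ≤ smoothImax ε₂ (redRB τ) := by
    refine le_iInf₂ fun ρ' hρ' => le_Imax fun σ hσ l hl => ?_
    obtain ⟨ω, hω, htr, hle⟩ := hP.exists_near hτ h₁ h₂ h.le hρ'
    obtain ⟨σ', hσ', hle'⟩ := hle _ _ σ hσ hl
    -- Equality of the `R` marginals turns `ρ'^R` into `ω^R`, as the definition of `Imax ω`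
    -- requires.
    rw [← htr, ← two_rpow_add_two_mul_cost P] at hle'
    have h3 : (x : EReal) ≤ (l + 2 * P.cost : ℝ) :=
      hx ▸ iInf₂_le_of_le ω hω (Imax_le hσ' hle')
    rw [EReal.coe_le_coe_iff] at h3 ⊢
    linarith
  rw [hy, EReal.coe_le_coe_iff] at key
  linarith

theorem IsStateRedistribution.geHalfDiff_smoothHmin {P : OneWayProtocol A B C TA TB TA' TB' Q}
    {τ : Matrix ((A × B × C) × R) ((A × B × C) × R) ℂ} (hτ : τ ∈ states _) {ε₁ ε₂ : ℝ}
    (hP : P.IsStateRedistribution τ ε₁) (h₁ : 0 ≤ ε₁) (h₂ : 0 ≤ ε₂) (h : ε₁ + ε₂ < 1) :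
    GeHalfDiff P.cost (smoothHmin ε₂ (redRB τ)) (smoothHmin (ε₁ + ε₂) (redRBC τ)) := by
  have := hP.nonempty_message hτ
  obtain ⟨x, hx⟩ := exists_real_eq_smoothHmin (redRBC_mem_states hτ) (add_nonneg h₁ h₂) h
  obtain ⟨y, hy⟩ := exists_real_eq_smoothHmin (redRB_mem_states hτ) h₂ (by linarith : ε₂ < 1)
  refine ⟨y, x, hy, hx, ?_⟩
  have key : smoothHmin ε₂ (redRB τ) ≤ ((x + 2 * P.cost : ℝ) : EReal) := by
    refine iSup₂_le fun ρ' hρ' => Hmin_le fun σ hσ l hl => ?_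
    obtain ⟨ω, hω, -, hle⟩ := hP.exists_near hτ h₁ h₂ h.le hρ'
    obtain ⟨σ', hσ', hle'⟩ := hle _ _ σ hσ hl
    rw [← two_rpow_add_two_mul_cost P] at hle'
    have h3 : -((l + 2 * P.cost : ℝ) : EReal) ≤ x :=
      hx ▸ le_iSup₂_of_le ω hω (neg_le_Hmin hσ' hle')
    rw [← EReal.coe_neg, EReal.coe_le_coe_iff] at h3 ⊢
    linarith
  rw [hy, EReal.coe_le_coe_iff] at key
  linarith

end OneWayProtocol

/-! ### Isometric dilations, left inverses and pure marginals -/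

section Dilations

variable {X Y Z X' Y' : Type*} [Fintype X] [DecidableEq X] [Fintype Y] [DecidableEq Y]
  [Fintype Z] [DecidableEq Z] [Fintype X'] [DecidableEq X'] [Fintype Y'] [DecidableEq Y']

/-- The map `M ↦ V M Vᴴ`. -/
def conjMap (V : Matrix Y X ℂ) : Matrix X X ℂ →ₗ[ℂ] Matrix Y Y ℂ where
  toFun M := V * M * Vᴴ
  map_add' M N := by rw [Matrix.mul_add, Matrix.add_mul]
  map_smul' c M := by simp

theorem conjMap_apply (V : Matrix Y X ℂ) (M : Matrix X X ℂ) : conjMap V M = V * M * Vᴴ := rfl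

theorem tensorId_conjMap (V : Matrix Y X ℂ) (M : Matrix (X × Z) (X × Z) ℂ) :
    tensorId Z (conjMap V) M = (V ⊗ₖ (1 : Matrix Z Z ℂ)) * M * (V ⊗ₖ (1 : Matrix Z Z ℂ))ᴴ := by
  ext p p'
  simp [tensorId, conjMap, Matrix.mul_apply, Fintype.sum_prod_type, Matrix.one_apply,
    apply_ite (starRingEnd ℂ)]

theorem conjMap_isChannel {V : Matrix Y X ℂ} (hV : Vᴴ * V = 1) : IsChannel (conjMap V) := by
  refine ⟨fun k M hM => ?_, fun M => ?_⟩
  · rw [tensorId_conjMap]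
    exact hM.mul_mul_conjTranspose_same _
  · rw [conjMap_apply, trace_mul_comm, ← Matrix.mul_assoc, hV, Matrix.one_mul]

/-- Stinespring's dilation theorem. -/
theorem IsChannel.exists_dilation {Φ : Matrix X X ℂ →ₗ[ℂ] Matrix Y Y ℂ} (hΦ : IsChannel Φ) :
    ∃ (n : ℕ) (V : Matrix (Y × Fin n) X ℂ), Vᴴ * V = 1 ∧ ∀ M, Φ M = traceSnd (V * M * Vᴴ) := by
  -- The unnormalized maximally entangled vector: a factor `G` of the resulting Choi operator, with
  -- its indices regrouped, is the Stinespring isometry.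
  let ω : X × X → ℂ := fun p => if p.1 = p.2 then 1 else 0
  obtain ⟨G₀, hG₀⟩ := exists_mul_conjTranspose_eq
    (tensorId_posSemidef (Z := X) hΦ (posSemidef_vecMulVec_self_star ω))
  let G := G₀.submatrix id (Fintype.equivFin (Y × X)).symm
  have hG : G * Gᴴ = tensorId X Φ (vecMulVec ω (star ω)) := by
    rw [← hG₀, conjTranspose_submatrix, submatrix_mul_equiv, submatrix_id_id]
  have hJ : ∀ y y' x x', (G * Gᴴ) (y, x) (y', x') = Φ (Matrix.single x x' 1) y y' := by
    intro y y' x x'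
    rw [hG]
    have : (Matrix.of fun i j => vecMulVec ω (star ω) (i, x) (j, x')) = Matrix.single x x' 1 := by
      ext i j
      simp only [of_apply, vecMulVec_apply, ω, Pi.star_apply, Matrix.single_apply,
        eq_comm (a := x), eq_comm (a := x')]
      by_cases h1 : i = x <;> by_cases h2 : j = x' <;> simp [h1, h2]
    rw [← this]
    rfl
  have hM : ∀ M : Matrix X X ℂ, M = ∑ x, ∑ x', M x x' • Matrix.single x x' (1 : ℂ) := by
    intro M
    conv_lhs => rw [Matrix.matrix_eq_sum_single M]
    simp
  refine ⟨_, Matrix.of fun p x => G (p.1, x) p.2, ?_, fun M => ?_⟩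
  · ext x x'
    have h := hΦ.2 (Matrix.single x' x 1)
    simp only [Matrix.trace, Matrix.diag_apply, ← hJ] at h
    simp only [Matrix.mul_apply, conjTranspose_apply, of_apply] at h ⊢
    rw [Fintype.sum_prod_type]
    simp only [mul_comm (star _)]
    rw [h]
    simp [Matrix.single_apply, Matrix.one_apply, ite_and]
  · ext y y'
    conv_lhs => rw [hM M]
    simp only [map_sum, map_smul, Matrix.sum_apply, Matrix.smul_apply, ← hJ]
    simp only [traceSnd, of_apply, Matrix.mul_apply, conjTranspose_apply, smul_eq_mul,
      Finset.mul_sum, Finset.sum_mul]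
    rw [Finset.sum_comm]
    symm
    rw [Finset.sum_comm]
    refine Finset.sum_congr rfl fun x' _ => ?_
    rw [Finset.sum_comm]
    exact Finset.sum_congr rfl fun x _ => Finset.sum_congr rfl fun e _ => by ring

/-- A channel that undoes the isometry `V`. -/
theorem exists_channel_leftInverse [Nonempty X] {V : Matrix Y X ℂ} (hV : Vᴴ * V = 1) :
    ∃ L : Matrix Y Y ℂ →ₗ[ℂ] Matrix X X ℂ, IsChannel L ∧ ∀ M, L (V * M * Vᴴ) = M := by
  have hs := single_mem_states (Classical.arbitrary X)
  set s := Matrix.single (Classical.arbitrary X) (Classical.arbitrary X) (1 : ℂ)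
  set E : Matrix Y Y ℂ := 1 - V * Vᴴ with hE
  have hEh : Eᴴ = E := by simp [hE]
  have hEV : E * V = 0 := by
    rw [hE, Matrix.sub_mul, Matrix.mul_assoc, hV]; simp
  have hEE : E * E = E := by
    conv_lhs => rhs; rw [hE]
    rw [Matrix.mul_sub, ← Matrix.mul_assoc, hEV]; simp
  -- `Vᴴ N V` inverts on the range of `V`; weight on the complement, cut out by `E`, is sent to a
  -- fixed state to preserve the trace.
  let L : Matrix Y Y ℂ →ₗ[ℂ] Matrix X X ℂ :=
    conjMap Vᴴ + ((Matrix.traceLinearMap Y ℂ ℂ) ∘ₗ conjMap E).smulRight s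
  have hL : ∀ N, L N = Vᴴ * N * V + (E * N * E).trace • s := by
    intro N
    simp [L, conjMap_apply, hEh]
  refine ⟨L, ⟨fun k N hN => ?_, fun N => ?_⟩, fun M => ?_⟩
  · have h1 := hN.mul_mul_conjTranspose_same (Vᴴ ⊗ₖ (1 : Matrix (Fin k) (Fin k) ℂ))
    have h2 := hN.mul_mul_conjTranspose_same (E ⊗ₖ (1 : Matrix (Fin k) (Fin k) ℂ))
    have h3 := hs.1.kronecker (traceSnd_posSemidef (h2.submatrix Prod.swap))
    convert h1.add h3 using 1
    rw [← tensorId_conjMap, ← tensorId_conjMap]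
    ext p p'
    simp [tensorId, L, traceSnd, Matrix.trace, mul_comm]
  · rw [hL, trace_add, trace_smul, hs.2, smul_eq_mul, mul_one, trace_mul_comm (E * N),
      ← Matrix.mul_assoc, hEE, Matrix.mul_assoc, trace_mul_comm, Matrix.mul_assoc, trace_mul_comm N,
      ← trace_add, ← Matrix.add_mul, hE, add_sub_cancel, Matrix.one_mul]
  · rw [hL]
    have e1 : E * (V * M * Vᴴ) * E = 0 := by
      rw [← Matrix.mul_assoc, ← Matrix.mul_assoc, hEV]; simp
    rw [e1, ← Matrix.mul_assoc, ← Matrix.mul_assoc, hV, Matrix.one_mul, Matrix.mul_assoc, hV]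
    simp

theorem isChannel_reindex {Φ : Matrix X X ℂ →ₗ[ℂ] Matrix Y Y ℂ} (hΦ : IsChannel Φ)
    (e : X' ≃ X) (f : Y ≃ Y') :
    IsChannel ((Matrix.reindexLinearEquiv ℂ ℂ f f).toLinearMap ∘ₗ Φ ∘ₗ
      (Matrix.reindexLinearEquiv ℂ ℂ e e).toLinearMap) := by
  refine ⟨fun k M hM => ?_, fun M => ?_⟩
  · exact (tensorId_posSemidef (Z := Fin k) hΦ (hM.submatrix fun p : X × Fin k =>
      (e.symm p.1, p.2))).submatrix fun p : Y' × Fin k => (f.symm p.1, p.2)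
  · simp only [LinearMap.comp_apply, LinearEquiv.coe_coe, coe_reindexLinearEquiv, reindex_apply,
      trace_submatrix_equiv, hΦ.2]

/-- An operator with a pure marginal is a product. -/
theorem eq_kronecker_of_traceSnd_eq_ketbra {T : Matrix (X × Y) (X × Y) ℂ} (hT : T.PosSemidef)
    {ψ : X → ℂ} (h : traceSnd T = ketbra ψ) (hψ : (ketbra ψ).trace = 1) :
    T = ketbra ψ ⊗ₖ traceFst T := by
  obtain ⟨g, rfl⟩ := exists_mul_conjTranspose_eq hT
  have hp : star ψ ⬝ᵥ ψ = 1 := by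
    rw [ketbra, trace_vecMulVec] at hψ
    rw [dotProduct_comm, hψ]
  have hτh : (ketbra ψ)ᴴ = ketbra ψ := (posSemidef_vecMulVec_self_star ψ).1
  have hττ : ketbra ψ * ketbra ψ = ketbra ψ := by
    rw [ketbra, vecMulVec_mul_vecMulVec, hp, one_smul]
  -- Purity of the marginal confines the `X` index of every factor to the line of `ψ`, whence `g = ψ
  -- ⊗ u`.
  have hz : (1 - ketbra ψ) * shift g = 0 := by
    rw [← self_mul_conjTranspose_eq_zero, conjTranspose_mul, Matrix.mul_assoc,
      ← Matrix.mul_assoc (shift g), shift_mul_conjTranspose, h, ← Matrix.mul_assoc,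
      Matrix.sub_mul, hττ]
    simp
  rw [Matrix.sub_mul, Matrix.one_mul, sub_eq_zero] at hz
  have hg : ∀ x y k, g (x, y) k = ψ x * (star ψ ᵥ* shift g) (y, k) := by
    intro x y k
    have := congrFun (congrFun hz x) (y, k)
    rw [ketbra, vecMulVec_mul, vecMulVec_apply] at this
    exact this
  set u := star ψ ᵥ* shift g
  have hψ' : ∑ x, ψ x * star (ψ x) = 1 := by
    simpa [ketbra, trace_vecMulVec, dotProduct] using hψ
  ext ⟨x, y⟩ ⟨x', y'⟩
  simp only [Matrix.mul_apply, conjTranspose_apply, kroneckerMap_apply, traceFst, of_apply, hg,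
    ketbra, vecMulVec_apply, Pi.star_apply]
  have e : ∀ (z : X) (k : X × Y), ψ z * u (y, k) * star (ψ z * u (y', k)) =
      (ψ z * star (ψ z)) * (u (y, k) * star (u (y', k))) := by
    intro z k
    rw [star_mul']; ring
  simp only [e, ← Finset.mul_sum, ← Finset.sum_mul, hψ', one_mul]
  rw [Finset.mul_sum]
  exact Finset.sum_congr rfl fun k _ => by rw [star_mul']; ring

end Dilations

/-! ### Reversing a redistribution protocol -/

namespace OneWayProtocol

variable {A B C R TA TB TA' TB' Q EA EB : Type*}
  [Fintype A] [DecidableEq A] [Fintype B] [DecidableEq B] [Fintype C] [DecidableEq C]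
  [Fintype R] [DecidableEq R]
  [Fintype TA] [DecidableEq TA] [Fintype TB] [DecidableEq TB]
  [Fintype TA'] [DecidableEq TA'] [Fintype TB'] [DecidableEq TB']
  [Fintype Q] [DecidableEq Q] [Fintype EA] [DecidableEq EA] [Fintype EB] [DecidableEq EB]

/-- The regrouping that separates the environments from the final systems. -/
def environmentEquiv (A B C R TA' TB' EA EB : Type*) :
    ((((A × TA') × (C × B × TB')) × R) × (EA × EB)) ≃
      (((A × (TA' × EA)) × (C × B × (TB' × EB))) × R) where
  toFun p := (((p.1.1.1.1, (p.1.1.1.2, p.2.1)),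
    (p.1.1.2.1, p.1.1.2.2.1, (p.1.1.2.2.2, p.2.2))), p.1.2)
  invFun p := ((((p.1.1.1, p.1.1.2.1), (p.1.2.1, p.1.2.2.1, p.1.2.2.2.1)), p.2),
    (p.1.1.2.2, p.1.2.2.2.2))
  left_inv _ := rfl
  right_inv _ := rfl

/-- A protocol whose operations dilate those of `P` dilates `P`. -/
theorem tensorId_channel_eq_traceSnd (P : OneWayProtocol A B C TA TB TA' TB' Q)
    (P' : OneWayProtocol A B C TA TB (TA' × EA) (TB' × EB) Q)
    (hE : ∀ M p p', P.enc M p p' =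
      ∑ e, P'.enc M (p.1, (p.2.1, e), p.2.2) (p'.1, (p'.2.1, e), p'.2.2))
    (hD : ∀ M p p', P.dec M p p' =
      ∑ e, P'.dec M (p.1, p.2.1, (p.2.2, e)) (p'.1, p'.2.1, (p'.2.2, e)))
    (M : Matrix (((A × C × TA) × (B × TB)) × R) (((A × C × TA) × (B × TB)) × R) ℂ) :
    tensorId R P.channel M =
      traceSnd ((tensorId R P'.channel M).submatrix (environmentEquiv A B C R TA' TB' EA EB)
        (environmentEquiv A B C R TA' TB' EA EB)) := by
  ext p p'
  rw [tensorId_channel_apply, tensorId_channel_apply]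
  simp only [traceSnd, submatrix_apply, of_apply, Fintype.sum_prod_type]
  have h : ∀ z z' : (A × TA') × R,
      (Matrix.of fun x x' : Q × B × TB => P.afterSend M (x, z) (x', z')) =
        ∑ e, Matrix.of fun x x' : Q × B × TB =>
          P'.afterSend M (x, ((z.1.1, (z.1.2, e)), z.2)) (x', ((z'.1.1, (z'.1.2, e)), z'.2)) := by
    intro z z'
    ext x x'
    rw [Matrix.sum_apply]
    exact hE _ _ _
  change P.dec (Matrix.of fun x x' => P.afterSend M (x, (p.1.1, p.2)) (x', (p'.1.1, p'.2)))
    p.1.2 p'.1.2 = _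
  rw [h, map_sum, Matrix.sum_apply]
  exact Finset.sum_congr rfl fun e _ => hD _ _ _

set_option synthInstance.maxSize 1000 in
/-- An extension of `Φ₂ ⊗ ρ^{ABCR}`, with `ρ^{ABCR}` pure, to the environments is again of
this form. -/
theorem exists_target_of_traceSnd_eq_target
    {τ : Matrix ((A × B × C) × R) ((A × B × C) × R) ℂ} (hτ : τ ∈ states _)
    {ψ : (A × B × C) × R → ℂ} (hψ : τ = ketbra ψ)
    {Φ₂ : Matrix (TA' × TB') (TA' × TB') ℂ} (hΦ₂ : Φ₂ ∈ states _)
    {T : Matrix ((((A × TA') × (C × B × TB')) × R) × (EA × EB))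
      ((((A × TA') × (C × B × TB')) × R) × (EA × EB)) ℂ} (hT : T.PosSemidef)
    (hTr : traceSnd T = target Φ₂ τ) :
    ∃ Φ ∈ states ((TA' × EA) × (TB' × EB)),
      T.submatrix (environmentEquiv A B C R TA' TB' EA EB).symm
        (environmentEquiv A B C R TA' TB' EA EB).symm = target Φ τ := by
  set e := environmentEquiv A B C R TA' TB' EA EB
  let f := targetEquiv A B C R (TA' × EA) (TB' × EB)
  let g := (Equiv.prodComm _ _).trans (f.symm.trans e.symm)
  have hmarg : traceSnd (T.submatrix g g) = ketbra ψ := by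
    have h1 : traceSnd (T.submatrix g g) = traceFst ((traceSnd T).submatrix
        (targetEquiv A B C R TA' TB').symm (targetEquiv A B C R TA' TB').symm) := by
      ext p p'
      simp only [traceSnd, traceFst, of_apply, submatrix_apply, Fintype.sum_prod_type]
      exact Finset.sum_congr rfl fun t _ => Finset.sum_comm
    rw [h1, hTr, target_eq, submatrix_submatrix, Equiv.self_comp_symm, submatrix_id_id, ← hψ]
    have h' : ∑ x, Φ₂ x x = 1 := hΦ₂.2
    ext p p'
    simp [traceFst, ← Finset.sum_mul, h']
  have htar := target_mem_states hΦ₂ hτ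
  -- `A B C R` is in the pure state `ψ`, so it is uncorrelated with the leftover entanglement and
  -- the environments, whose joint state is the new `Φ`.
  have hprod := eq_kronecker_of_traceSnd_eq_ketbra (hT.submatrix g) hmarg
    (by rw [← hψ]; exact hτ.2)
  set Φ := traceFst (T.submatrix g g)
  have hTΦ : T.submatrix e.symm e.symm = target Φ τ := by
    have h1 : (T.submatrix g g).submatrix (f.trans (Equiv.prodComm _ _))
        (f.trans (Equiv.prodComm _ _)) = T.submatrix e.symm e.symm := by
      ext p p'
      simp [g]
    rw [← h1, hprod, ← hψ, target_eq]
    ext p p'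
    exact mul_comm (_ : ℂ) _
  have hΦ : Φ ∈ states _ := by
    refine traceFst_mem_states ⟨hT.submatrix g, ?_⟩
    rw [trace_submatrix_equiv, ← trace_traceSnd, hTr, htar.2]
  exact ⟨Φ, hΦ, hTΦ⟩

set_option synthInstance.maxSize 1000 in
/-- Every protocol is dilated by one with isometric operations, which redistributes the same
states with the same error. -/
theorem IsStateRedistribution.exists_isometric {P : OneWayProtocol A B C TA TB TA' TB' Q}
    {τ : Matrix ((A × B × C) × R) ((A × B × C) × R) ℂ} (hτ : τ ∈ states _)
    {ψ : (A × B × C) × R → ℂ} (hψ : τ = ketbra ψ) {ε : ℝ} (hε : 0 ≤ ε)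
    (hP : P.IsStateRedistribution τ ε) :
    ∃ (n m : ℕ) (P' : OneWayProtocol A B C TA TB (TA' × Fin n) (TB' × Fin m) Q)
      (V : Matrix _ _ ℂ) (W : Matrix _ _ ℂ), Vᴴ * V = 1 ∧ Wᴴ * W = 1 ∧
        P'.enc = conjMap V ∧ P'.dec = conjMap W ∧ P'.IsStateRedistribution τ ε := by
  obtain ⟨Φ₁, hΦ₁, Φ₂, hΦ₂, hd⟩ := hP
  obtain ⟨n, V₀, hV₀, hV₀e⟩ := P.enc_isChannel.exists_dilation
  obtain ⟨m, W₀, hW₀, hW₀e⟩ := P.dec_isChannel.exists_dilation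
  let eV : (A × (TA' × Fin n) × Q) ≃
      ((A × TA' × Q) × Fin n) :=
    { toFun := fun p => ((p.1, p.2.1.1, p.2.2), p.2.1.2)
      invFun := fun p => (p.1.1, (p.1.2.1, p.2), p.1.2.2)
      left_inv := fun _ => rfl
      right_inv := fun _ => rfl }
  let eW : (C × B × (TB' × Fin m)) ≃
      ((C × B × TB') × Fin m) :=
    { toFun := fun p => ((p.1, p.2.1, p.2.2.1), p.2.2.2)
      invFun := fun p => (p.1.1, p.1.2.1, (p.1.2.2, p.2))
      left_inv := fun _ => rfl
      right_inv := fun _ => rfl }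
  have hV : (V₀.submatrix eV id)ᴴ * V₀.submatrix eV id = 1 := by
    rw [conjTranspose_submatrix, submatrix_mul_equiv, hV₀, submatrix_id_id]
  have hW : (W₀.submatrix eW id)ᴴ * W₀.submatrix eW id = 1 := by
    rw [conjTranspose_submatrix, submatrix_mul_equiv, hW₀, submatrix_id_id]
  let P' : OneWayProtocol A B C TA TB (TA' × Fin n)
      (TB' × Fin m) Q :=
    { enc := conjMap (V₀.submatrix eV id)
      dec := conjMap (W₀.submatrix eW id)
      enc_isChannel := conjMap_isChannel hV
      dec_isChannel := conjMap_isChannel hW }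
  refine ⟨n, m, P', _, _, hV, hW, rfl, rfl, Φ₁, hΦ₁, ?_⟩
  have hin := input_mem_states hΦ₁ hτ
  have hout := P.tensorId_channel_mem_states hin
  have hout' := P'.tensorId_channel_mem_states hin
  have htar := target_mem_states hΦ₂ hτ
  obtain ⟨x⟩ := nonempty_of_mem_states hout'
  have : Nonempty (Fin n × Fin m) := ⟨(x.1.1.2.2, x.1.2.2.2.2)⟩
  set e := environmentEquiv A B C R TA' TB' (Fin n) (Fin m)
  have hdil : tensorId R P.channel (input Φ₁ τ) =
      traceSnd ((tensorId R P'.channel (input Φ₁ τ)).submatrix e e) := by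
    refine tensorId_channel_eq_traceSnd P P' (fun M p p' => ?_) (fun M p p' => ?_) _
    · rw [hV₀e]; rfl
    · rw [hW₀e]; rfl
  -- The environments stay with Alice and Bob, and the target is extended to them without losing
  -- fidelity to the dilated output.
  obtain ⟨T, hT, hTr, hTf⟩ := exists_extension_fidelity_le (hout'.1.submatrix e) htar.1
  rw [← hdil] at hTf
  obtain ⟨Φ, hΦ, hTΦ⟩ := exists_target_of_traceSnd_eq_target hτ hψ hΦ₂ hT hTr
  refine ⟨Φ, hΦ, ?_⟩
  rw [purifiedDist_le_iff hout' hε]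
  refine ((purifiedDist_le_iff hout hε).1 hd).trans (pow_le_pow_left₀ (fidelity_nonneg _ _) ?_ 2)
  refine hTf.trans ((fidelity_le_submatrix (hout'.1.submatrix e) hT e.symm).trans_eq ?_)
  rw [hTΦ, submatrix_submatrix, Equiv.self_comp_symm, submatrix_id_id]

/-- Exchanges the roles of `A` and `B`. -/
def exchangeEquiv (A B C R : Type*) : ((B × A × C) × R) ≃ ((A × B × C) × R) where
  toFun p := ((p.1.2.1, p.1.1, p.1.2.2), p.2)
  invFun p := ((p.1.2.1, p.1.1, p.1.2.2), p.2)
  left_inv _ := rfl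
  right_inv _ := rfl

/-- The final systems of a protocol as initial systems of a reversed protocol. -/
def finalEquiv (A B C R TA' TB' : Type*) :
    (((B × C × TB') × (A × TA')) × R) ≃ (((A × TA') × (C × B × TB')) × R) where
  toFun p := ((p.1.2, (p.1.1.2.1, p.1.1.1, p.1.1.2.2)), p.2)
  invFun p := (((p.1.2.2.1, p.1.2.1, p.1.2.2.2), p.1.1), p.2)
  left_inv _ := rfl
  right_inv _ := rfl

/-- The initial systems of a protocol as final systems of a reversed protocol. -/
def initialEquiv (A B C R TA TB : Type*) :
    (((B × TB) × (C × A × TA)) × R) ≃ (((A × C × TA) × (B × TB)) × R) where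
  toFun p := (((p.1.2.2.1, p.1.2.1, p.1.2.2.2), p.1.1), p.2)
  invFun p := ((p.1.2, (p.1.1.2.1, p.1.1.1, p.1.1.2.2)), p.2)
  left_inv _ := rfl
  right_inv _ := rfl

/-- A protocol with reversible operations, run backwards, redistributes the state with the roles of
Alice and Bob exchanged. -/
theorem IsStateRedistribution.exists_reverse_of_leftInverse
    {P : OneWayProtocol A B C TA TB TA' TB' Q}
    {τ : Matrix ((A × B × C) × R) ((A × B × C) × R) ℂ} (hτ : τ ∈ states _) {ε : ℝ} (hε : 0 ≤ ε)
    (hP : P.IsStateRedistribution τ ε)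
    {L : Matrix (A × TA' × Q) (A × TA' × Q) ℂ →ₗ[ℂ] Matrix (A × C × TA) (A × C × TA) ℂ}
    (hL : IsChannel L) (hLe : ∀ M, L (P.enc M) = M)
    {K : Matrix (C × B × TB') (C × B × TB') ℂ →ₗ[ℂ] Matrix (Q × B × TB) (Q × B × TB) ℂ}
    (hK : IsChannel K) (hKe : ∀ M, K (P.dec M) = M) :
    ∃ P' : OneWayProtocol B A C TB' TA' TB TA Q, P'.IsStateRedistribution
      (τ.submatrix (exchangeEquiv A B C R) (exchangeEquiv A B C R)) ε := by
  obtain ⟨Φ₁, hΦ₁, Φ₂, hΦ₂, hd⟩ := hP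
  let e₁ : (B × C × TB') ≃ (C × B × TB') :=
    { toFun := fun p => (p.2.1, p.1, p.2.2)
      invFun := fun p => (p.2.1, p.1, p.2.2)
      left_inv := fun _ => rfl
      right_inv := fun _ => rfl }
  let e₂ : (Q × B × TB) ≃ (B × TB × Q) :=
    { toFun := fun p => (p.2.1, p.2.2, p.1)
      invFun := fun p => (p.2.2, p.1, p.2.1)
      left_inv := fun _ => rfl
      right_inv := fun _ => rfl }
  let e₃ : (Q × A × TA') ≃ (A × TA' × Q) :=
    { toFun := fun p => (p.2.1, p.2.2, p.1)
      invFun := fun p => (p.2.2, p.1, p.2.1)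
      left_inv := fun _ => rfl
      right_inv := fun _ => rfl }
  let e₄ : (A × C × TA) ≃ (C × A × TA) :=
    { toFun := fun p => (p.2.1, p.1, p.2.2)
      invFun := fun p => (p.2.1, p.1, p.2.2)
      left_inv := fun _ => rfl
      right_inv := fun _ => rfl }
  let P' : OneWayProtocol B A C TB' TA' TB TA Q :=
    { enc := _
      dec := _
      enc_isChannel := isChannel_reindex hK e₁ e₂
      dec_isChannel := isChannel_reindex hL e₃ e₄ }
  -- The reversed protocol undoes the original: `K` inverts Bob's operation, `Q` returns, and `L`
  -- inverts Alice's.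
  have hrev : ∀ M : Matrix (((A × C × TA) × (B × TB)) × R) (((A × C × TA) × (B × TB)) × R) ℂ,
      tensorId R P'.channel ((tensorId R P.channel M).submatrix (finalEquiv A B C R TA' TB')
        (finalEquiv A B C R TA' TB')) =
      M.submatrix (initialEquiv A B C R TA TB) (initialEquiv A B C R TA TB) := by
    intro M
    have h1 : P'.afterSend ((tensorId R P.channel M).submatrix (finalEquiv A B C R TA' TB')
        (finalEquiv A B C R TA' TB')) =
        Matrix.of fun p p' => P.afterSend M ((p.1.1, p.2.1.1, p.2.1.2), ((p.1.2.1, p.1.2.2), p.2.2))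
          ((p'.1.1, p'.2.1.1, p'.2.1.2), ((p'.1.2.1, p'.1.2.2), p'.2.2)) := by
      ext p p'
      exact congrFun (congrFun (hKe (Matrix.of fun x x' =>
        P.afterSend M (x, ((p.1.2.1, p.1.2.2), p.2.2)) (x', ((p'.1.2.1, p'.1.2.2), p'.2.2))))
          (p.1.1, p.2.1.1, p.2.1.2)) (p'.1.1, p'.2.1.1, p'.2.1.2)
    rw [tensorId_channel_apply, h1]
    ext p p'
    exact congrFun (congrFun (hLe (Matrix.of fun x x' =>
      M ((x, p.1.1), p.2) ((x', p'.1.1), p'.2))) (p.1.2.2.1, p.1.2.1, p.1.2.2.2))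
        (p'.1.2.2.1, p'.1.2.1, p'.1.2.2.2)
  have hin := input_mem_states hΦ₁ hτ
  have hout := P.tensorId_channel_mem_states hin
  have htar := target_mem_states hΦ₂ hτ
  have hΦ₁' := submatrix_mem_states hΦ₁ (Equiv.prodComm TB TA)
  have hΦ₂' := submatrix_mem_states hΦ₂ (Equiv.prodComm TB' TA')
  have hτ' := submatrix_mem_states hτ (exchangeEquiv A B C R)
  refine ⟨P', _, hΦ₂', _, hΦ₁', ?_⟩
  rw [purifiedDist_le_iff (P'.tensorId_channel_mem_states (input_mem_states hΦ₂' hτ')) hε]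
  refine ((purifiedDist_le_iff hout hε).1 hd).trans (pow_le_pow_left₀ (fidelity_nonneg _ _) ?_ 2)
  -- The reversed protocol is applied to both `target` and the actual output. The former is its own
  -- input, the latter returns to `input Φ₁ τ`, its target, and monotonicity bounds the error.
  rw [fidelity_comm hout.1 htar.1]
  refine (fidelity_le_submatrix htar.1 hout.1 (finalEquiv A B C R TA' TB')).trans ?_
  refine (fidelity_le_tensorId P'.channel_isChannel (htar.1.submatrix _)
    (hout.1.submatrix _)).trans_eq ?_
  rw [hrev]
  rfl

/-- State redistribution can be reversed, with the same message, exchanging Alice and Bob. -/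
theorem IsStateRedistribution.exists_reverse {P : OneWayProtocol A B C TA TB TA' TB' Q}
    {τ : Matrix ((A × B × C) × R) ((A × B × C) × R) ℂ} (hτ : τ ∈ states _)
    {ψ : (A × B × C) × R → ℂ} (hψ : τ = ketbra ψ) {ε : ℝ} (hε : 0 ≤ ε)
    (hP : P.IsStateRedistribution τ ε) :
    ∃ (n m : ℕ) (P' : OneWayProtocol B A C (TB' × Fin m) (TA' × Fin n) TB TA Q), P'.IsStateRedistribution
      (τ.submatrix (exchangeEquiv A B C R) (exchangeEquiv A B C R)) ε := by
  obtain ⟨q⟩ := hP.nonempty_message hτ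
  obtain ⟨n, m, P', V, W, hV, hW, hPV, hPW, hP'⟩ := hP.exists_isometric hτ hψ hε
  obtain ⟨⟨⟨a, b, c⟩, r⟩⟩ := nonempty_of_mem_states hτ
  obtain ⟨Φ₁, hΦ₁, -⟩ := hP
  obtain ⟨⟨ta, tb⟩⟩ := nonempty_of_mem_states hΦ₁
  have : Nonempty (A × C × TA) := ⟨(a, c, ta)⟩
  have : Nonempty (Q × B × TB) := ⟨(q, b, tb)⟩
  obtain ⟨L, hL, hLV⟩ := exists_channel_leftInverse hV
  obtain ⟨K, hK, hKW⟩ := exists_channel_leftInverse hW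
  exact ⟨n, m, hP'.exists_reverse_of_leftInverse hτ hε hL (fun M => by rw [hPV]; exact hLV M)
    hK (fun M => by rw [hPW]; exact hKW M)⟩

end OneWayProtocol

end QSR

/-! ### The six bounds -/

open QSR QSR.OneWayProtocol in
theorem mainTheorem4
    {A B C R TA TB TA' TB' Q : Type*}
    [Fintype A] [DecidableEq A] [Fintype B] [DecidableEq B]
    [Fintype C] [DecidableEq C] [Fintype R] [DecidableEq R]
    [Fintype TA] [DecidableEq TA] [Fintype TB] [DecidableEq TB]
    [Fintype TA'] [DecidableEq TA'] [Fintype TB'] [DecidableEq TB']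
    [Fintype Q] [DecidableEq Q]
    (ε₁ ε₂ : ℝ) (hε₁ : ε₁ ∈ Set.Ioo (0 : ℝ) 1) (hε₂ : ε₂ ∈ Set.Ioo (0 : ℝ) (1 - ε₁))
    (ρ : Matrix (A × B × C) (A × B × C) ℂ) (hρ : ρ ∈ QSR.states (A × B × C))
    (τ : Matrix ((A × B × C) × R) ((A × B × C) × R) ℂ) (hτ : QSR.IsPurification τ ρ)
    (P : QSR.OneWayProtocol A B C TA TB TA' TB' Q) (hP : P.IsStateRedistribution τ ε₁) :
    (QSR.GeHalfDiff P.cost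
        (QSR.smoothImax (ε₁ + ε₂) (QSR.redRBC τ)) (QSR.smoothImax ε₂ (QSR.redRB τ)) ∧
      QSR.GeHalfDiff P.cost
        (QSR.smoothHmin ε₂ (QSR.redRB τ)) (QSR.smoothHmin (ε₁ + ε₂) (QSR.redRBC τ)) ∧
      QSR.GeHalfDiff P.cost
        (QSR.smoothHmax (ε₁ + ε₂) (QSR.redRB τ)) (QSR.smoothHmax ε₂ (QSR.redRBC τ))) ∧
    (QSR.GeHalfDiff P.cost
        (QSR.smoothImax (ε₁ + ε₂) (QSR.redRAC τ)) (QSR.smoothImax ε₂ (QSR.redRA τ)) ∧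
      QSR.GeHalfDiff P.cost
        (QSR.smoothHmin ε₂ (QSR.redRA τ)) (QSR.smoothHmin (ε₁ + ε₂) (QSR.redRAC τ)) ∧
      QSR.GeHalfDiff P.cost
        (QSR.smoothHmax (ε₁ + ε₂) (QSR.redRA τ)) (QSR.smoothHmax ε₂ (QSR.redRAC τ))) := by
  obtain ⟨⟨ψ, hψ⟩, hτρ⟩ := hτ
  have h₁ : 0 ≤ ε₁ := hε₁.1.le
  have h₂ : 0 ≤ ε₂ := hε₂.1.le
  have h : ε₁ + ε₂ < 1 := by linarith [hε₂.2]
  have hτs : τ ∈ states _ := by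
    refine ⟨?_, ?_⟩
    · rw [hψ]
      exact Matrix.posSemidef_vecMulVec_self_star ψ
    · rw [← trace_traceSnd, hτρ, hρ.2]
  obtain ⟨n, m, P', hP'⟩ := hP.exists_reverse hτs hψ h₁
  set τ' := τ.submatrix (exchangeEquiv A B C R) (exchangeEquiv A B C R)
  have hτs' : τ' ∈ states _ := submatrix_mem_states hτs _
  have hψ' : τ' = ketbra (ψ ∘ exchangeEquiv A B C R) := by
    simp only [τ', hψ]
    rfl
  have neg_swap : ∀ {q : ℝ} {x y : EReal}, GeHalfDiff q x y → GeHalfDiff q (-y) (-x) := by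
    rintro q x y ⟨a, b, rfl, rfl, hq⟩
    exact ⟨-b, -a, (EReal.coe_neg b).symm, (EReal.coe_neg a).symm, by linarith⟩
  have hminB := hP.geHalfDiff_smoothHmin hτs h₁ h₂ h
  have hminA := hP'.geHalfDiff_smoothHmin hτs' h₁ h₂ h
  -- The reversed protocol sends the same `Q`, hence has the same cost, and the reductions of `τ'`
  -- to `R B`, `R B C` are by definition those of `τ` to `R A`, `R A C`.
  refine ⟨⟨hP.geHalfDiff_smoothImax hτs h₁ h₂ h, hminB, ?_⟩,
    ⟨hP'.geHalfDiff_smoothImax hτs' h₁ h₂ h, hminA, ?_⟩⟩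
  -- Duality turns Bob's max-entropy bound into Alice's min-entropy bound, and below conversely.
  · rw [smoothHmax_redRB hτs hψ (add_nonneg h₁ h₂), smoothHmax_redRBC hτs hψ h₂]
    exact neg_swap hminA
  · have e1 := smoothHmax_redRB hτs' hψ' (add_nonneg h₁ h₂)
    have e2 := smoothHmax_redRBC hτs' hψ' h₂
    change GeHalfDiff _ (smoothHmax (ε₁ + ε₂) (redRB τ')) (smoothHmax ε₂ (redRBC τ'))
    rw [e1, e2]
    exact neg_swap hminB
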